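/- Let $K\ge 2$ and $n\ge 1$. For $1\le j,k\le K$ let $E_{jk}$ be the matrix units of $M_K(\mathbb C)$. The Gell-Mann basis $\mathrm{GM}(K)=\{M_\lambda\}_{\lambda\in\Lambda_K}$ of $M_K(\mathbb C)$ consists of the identity $\mathbf I$, the matrices $\sqrt{K/2}\,(E_{jk}+E_{kj})$ and $\sqrt{K/2}\,(-iE_{jk}+iE_{kj})$ for $1\le j<k\le K$, and $\sqrt{K/(m^2+m)}\,\bigl(\sum_{k=1}^m E_{kk}-mE_{m+1,m+1}\bigr)$ for $1\le m\le K-1$. Every $\mathcal A\in M_K(\mathbb C)^{\otimes n}$ has a unique expansion $\mathcal A=\sum_{\alpha\in\Lambda_K^n}\widehat{\mathcal A}(\alpha)\,M_{\alpha_1}\otimes\cdots\otimes M_{\alpha_n}$; it is of degree at most $d$ if $\widehat{\mathcal A}(\alpha)=0$ whenever more than $d$ of the matrices $M_{\alpha_1},\dots,M_{\alpha_n}$ differ from $\mathbf I$. An observable is a Hermitian $\mathcal A\in M_K(\mathbb C)^{\otimes n}$, $\|\mathcal A\|_{\mathrm{op}}$ is its operator norm on $(\mathbb C^K)^{\otimes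 n}$, and $\|\mathcal A\|_2^2=K^{-n}\operatorname{tr}[\mathcal A^\dagger\mathcal A]$. A product state is a tensor product $\sigma_1\otimes\cdots\otimes\sigma_n$ of density matrices $\sigma_j\in M_K(\mathbb C)$ (positive semidefinite, of trace $1$). There are universal constants $C,C'>0$ such that the following holds. Let $K\ge 2$ and $n,d\ge 1$ be integers and let $\varepsilon,\delta,t>0$. Then there are a finite nonempty set $S$ of product states of $n$ qudits, an integer $s\ge 0$ with $$s\le C'\,\bigl(K\max\{t,1\}\bigr)^{C d^2}\,d^2\,\varepsilon^{-d-1}\,\log\bigl(\max\{n/\delta,\,2\}\bigr),$$ and a learning procedure (a map that assigns an observable to every list of $s$ pairs consisting of an $n$-qudit operator and a number) such that, for every observable $\mathcal A\in M_K(\mathbb C)^{\otimes n}$ of degree at most $d$ with $\|\mathcal A\|_{\mathrm{op}}\le t$: if $\rho_1,\dots,\rho_s$ are drawn independently and uniformly from $S$, then with probability at least $1-\delta$ the output $\widetilde{\mathcal A}$ of the procedure on the samples $(\rho_i,\operatorname{tr}[\mathcal A\rho_i])$, $1\le i\le s$, satisfies $\|\mathcal A-\widetilde{\mathcal A}\|_2^2\le\varepsilon$.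 -/

import Mathlib

noncomputable section

namespace Qudit

open scoped ComplexOrder

/-- Operators on `n` qudits of local dimension `K`: the algebra `M_K(ℂ)^{⊗ n}`, realised as the
matrices whose rows and columns are indexed by the computational basis `{0, …, K-1}^n`. -/
abbrev Op (K n : ℕ) : Type := Matrix (Fin n → Fin K) (Fin n → Fin K) ℂ

/-- The tensor product `M₁ ⊗ ⋯ ⊗ Mₙ` of one-qudit operators. -/
def tensor {K n : ℕ} (M : Fin n → Matrix (Fin K) (Fin K) ℂ) : Op K n :=
  Matrix.of fun x y => ∏ j, M j (x j) (y j)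

/-- The operator norm of `A` acting on the Hilbert space `(ℂ^K)^{⊗ n}`. -/
def opNorm {K n : ℕ} (A : Op K n) : ℝ :=
  ‖Matrix.toEuclideanCLM (𝕜 := ℂ) A‖

/-- The normalized inner product `⟨A, B⟩ = K^{-n} tr[A† B]`. -/
def inner₂ {K n : ℕ} (A B : Op K n) : ℂ :=
  ((K : ℂ) ^ n)⁻¹ * (A.conjTranspose * B).trace

/-- The squared normalized norm `‖A‖₂² = ⟨A, A⟩`. -/
def normSq₂ {K n : ℕ} (A : Op K n) : ℝ :=
  (inner₂ A A).re

/-- The pairs `j < k` of basis indices of one qudit. -/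
abbrev Pairs (K : ℕ) : Type := {p : Fin K × Fin K // p.1 < p.2}

/-- The index set of the Gell-Mann basis of `M_K(ℂ)`: `none` is the identity, and the three
summands index the symmetric, the antisymmetric and the diagonal matrices. -/
abbrev GMIndex (K : ℕ) : Type := Option (Pairs K ⊕ Pairs K ⊕ Fin (K - 1))

/-- The symmetric Gell-Mann matrix `√(K/2) (E_jk + E_kj)`. -/
def gmSym (K : ℕ) (p : Pairs K) : Matrix (Fin K) (Fin K) ℂ :=
  ((Real.sqrt ((K : ℝ) / 2) : ℝ) : ℂ) •
    (Matrix.single p.1.1 p.1.2 (1 : ℂ) + Matrix.single p.1.2 p.1.1 (1 : ℂ))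

/-- The antisymmetric Gell-Mann matrix `√(K/2) (-i E_jk + i E_kj)`. -/
def gmAntisym (K : ℕ) (p : Pairs K) : Matrix (Fin K) (Fin K) ℂ :=
  ((Real.sqrt ((K : ℝ) / 2) : ℝ) : ℂ) •
    (Matrix.single p.1.1 p.1.2 (-Complex.I) + Matrix.single p.1.2 p.1.1 Complex.I)

/-- The diagonal Gell-Mann matrix `Γ_m (∑_{k ≤ m} E_kk - m E_{m+1,m+1})` with
`Γ_m = √(K / (m² + m))`, for `1 ≤ m ≤ K - 1`. The index `i : Fin (K - 1)` stands for `m = i + 1`,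
and basis vectors are numbered from `0` here, so that `k ≤ m` becomes `k < m` and `k = m + 1`
becomes `k = m`. -/
def gmDiag (K : ℕ) (i : Fin (K - 1)) : Matrix (Fin K) (Fin K) ℂ :=
  let m : ℕ := (i : ℕ) + 1
  ((Real.sqrt ((K : ℝ) / ((m : ℝ) ^ 2 + (m : ℝ))) : ℝ) : ℂ) •
    Matrix.diagonal fun k : Fin K =>
      if (k : ℕ) < m then (1 : ℂ) else if (k : ℕ) = m then -(m : ℂ) else 0

/-- The Gell-Mann basis of `M_K(ℂ)`. -/
def gellMann (K : ℕ) : GMIndex K → Matrix (Fin K) (Fin K) ℂ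
  | none => 1
  | some (Sum.inl p) => gmSym K p
  | some (Sum.inr (Sum.inl p)) => gmAntisym K p
  | some (Sum.inr (Sum.inr i)) => gmDiag K i

/-- The weight `|α|`: the number of sites at which `α` is not the identity. -/
def weight {K n : ℕ} (α : Fin n → GMIndex K) : ℕ :=
  (Finset.univ.filter fun j => α j ≠ none).card

/-- `A` has degree at most `d`: in its expansion `A = ∑_α Â(α) M_{α₁} ⊗ ⋯ ⊗ M_{αₙ}` in the
Gell-Mann basis, `Â(α) = 0` whenever `|α| > d`. -/
def DegreeLE {K n : ℕ} (d : ℕ) (A : Op K n) : Prop :=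
  ∃ a : (Fin n → GMIndex K) → ℂ,
    (∀ α, d < weight α → a α = 0) ∧
      A = ∑ α, a α • tensor fun j => gellMann K (α j)

/-- A (mixed) state of one qudit: a density matrix. -/
def IsDensity {K : ℕ} (σ : Matrix (Fin K) (Fin K) ℂ) : Prop :=
  σ.PosSemidef ∧ σ.trace = 1

/-- A product state of `n` qudits: `σ₁ ⊗ ⋯ ⊗ σₙ` for one-qudit states `σ₁, …, σₙ`. -/
def IsProductState {K n : ℕ} (ρ : Op K n) : Prop :=
  ∃ σ : Fin n → Matrix (Fin K) (Fin K) ℂ, (∀ j, IsDensity (σ j)) ∧ ρ = tensor σ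

/-- The probability that `s` independent uniform draws from the finite set `S` have the
property `E`: the proportion of the tuples in `S^s` that have it. -/
def iidUniformProb {X : Type*} (S : Finset X) (s : ℕ) (E : (Fin s → X) → Prop) : ℝ :=
  (Nat.card {x : Fin s → S // E fun i => (x i : X)} : ℝ) / (S.card : ℝ) ^ s

/-- The data set `(ρᵢ, tr[A ρᵢ])`, `i < s`, that the states `ρᵢ` produce. -/
def samples {K n s : ℕ} (A : Op K n) (ρ : Fin s → Op K n) : Fin s → Op K n × ℂ :=
  fun i => (ρ i, (A * ρ i).trace)

end Qudit

end

/-! The problem is reduced to learning a bounded low-degree polynomial on a discrete cube. Attach a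
real variable to each pair of a site and a traceless Gell-Mann matrix. For `y` in the solid cube
`[-1,1]^N`, the one-qudit matrices with Bloch vectors `K^{-8} y` are density matrices, and pairing
their product with `𝒜` gives a multilinear polynomial `f(y)`. Its coefficients are the Gell-Mann
coefficients of `𝒜`, scaled by `K^{-7w}` at weight `w`. Hence `f` has degree at most `d`, and `|f| ≤
‖𝒜‖_op` on the whole solid cube. The states in `S` are those at the vertices, and sampling them
samples `f` at random vertices.

The number of variables enters the sample size only through a logarithm, because the sum over all
variables of the square roots of the influences of `f` is at most `B = 2·30^d T`, for any bound `T`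
of `|f|` (`sum_infl_le`). At half a vertex, a single directional derivative adds up all `|∂_i f|`,
and it is bounded because a polynomial in one variable bounded on `[-1,1]` has a bounded linear
coefficient (`abs_linear_coeff_le`). Averaging over the vertices and comparing first with second
moments (`secondMoment_le`, from `bonami`) turns the partial derivatives into root influences.

Consequently at most `B/τ` variables have root influence above `τ`. Coefficients whose set involves
another variable have total energy at most `τB`, and at most `1 + (B/τ)^d` low-degree sets remain
(`sum_min_sq_le`). If every empirical coefficient is accurate to `b`, discarding those below `2b`
costs at most `9 ∑ min(a_S², b²)`. A Chernoff and union bound provides this accuracy from about `T²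
b^{-2} log(N^d/δ)` samples (`le_card_emp_good`). Taking `τ` proportional to `ε` and `b² = τB(τ/B)^d`
gives the power `ε^{-d-1}`, and Parseval's identity transfers the error back to `𝒜`. -/

noncomputable section

/-! ### Fourier analysis and hypercontractivity on the discrete cube -/

namespace Cube

open Finset BigOperators

variable {ι : Type*}

/-- The sign `±1` encoded by a Boolean. -/
def sgn (b : Bool) : ℝ := if b then 1 else -1

lemma sgn_mul_self (b : Bool) : sgn b * sgn b = 1 := by cases b <;> simp [sgn]

lemma abs_sgn (b : Bool) : |sgn b| = 1 := by cases b <;> simp [sgn]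

lemma sgn_not (b : Bool) : sgn (!b) = -sgn b := by cases b <;> simp [sgn]

/-- The vertex of `[-1,1]^ι` encoded by a Boolean vector. -/
def vertex (x : ι → Bool) : ι → ℝ := fun i => sgn (x i)

/-- The squarefree monomial `∏_{i ∈ S} y_i`. -/
def mono (S : Finset ι) (y : ι → ℝ) : ℝ := ∏ i ∈ S, y i

lemma abs_mono_vertex (S : Finset ι) (x : ι → Bool) : |mono S (vertex x)| = 1 := by
  simp [mono, vertex, Finset.abs_prod, abs_sgn]

variable [DecidableEq ι]

/-- Negation of the coordinate `i`. -/
def flip (i : ι) (x : ι → Bool) : ι → Bool := Function.update x i (!x i)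

lemma flip_flip (i : ι) (x : ι → Bool) : flip i (flip i x) = x := by
  simp [flip]

lemma vertex_flip_self (i : ι) (x : ι → Bool) : vertex (flip i x) i = -vertex x i := by
  simp [vertex, flip, sgn_not]

lemma mono_flip_of_notMem {i : ι} {S : Finset ι} (h : i ∉ S) (x : ι → Bool) :
    mono S (vertex (flip i x)) = mono S (vertex x) := by
  refine Finset.prod_congr rfl fun j hj => ?_
  have : j ≠ i := fun e => h (e ▸ hj)
  simp [vertex, flip, this]

lemma mono_insert {i : ι} {S : Finset ι} (h : i ∉ S) (y : ι → ℝ) :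
    mono (insert i S) y = y i * mono S y := Finset.prod_insert h

lemma mono_flip_of_mem {i : ι} {S : Finset ι} (h : i ∈ S) (x : ι → Bool) :
    mono S (vertex (flip i x)) = -mono S (vertex x) := by
  rw [← Finset.insert_erase h, mono_insert (Finset.notMem_erase i S),
    mono_insert (Finset.notMem_erase i S), mono_flip_of_notMem (Finset.notMem_erase i S),
    vertex_flip_self, neg_mul]

/-- The multilinear polynomial with coefficients `a` in the variables `s`. -/
def polyOn (s : Finset ι) (a : Finset ι → ℝ) (y : ι → ℝ) : ℝ :=
  ∑ S ∈ s.powerset, a S * mono S y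

lemma polyOn_insert {i : ι} {s : Finset ι} (hi : i ∉ s) (a : Finset ι → ℝ) (y : ι → ℝ) :
    polyOn (insert i s) a y = polyOn s a y + y i * polyOn s (fun S => a (insert i S)) y := by
  rw [polyOn, Finset.sum_powerset_insert hi, polyOn, polyOn, Finset.mul_sum]
  congr 1
  refine Finset.sum_congr rfl fun S hS => ?_
  rw [mono_insert fun h => hi (Finset.mem_powerset.1 hS h)]
  ring

lemma polyOn_flip {i : ι} {s : Finset ι} (hi : i ∉ s) (a : Finset ι → ℝ) (x : ι → Bool) :
    polyOn s a (vertex (flip i x)) = polyOn s a (vertex x) := by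
  refine Finset.sum_congr rfl fun S hS => ?_
  rw [mono_flip_of_notMem fun h => hi (Finset.mem_powerset.1 hS h)]

variable [Fintype ι]

lemma expect_eq_zero_of_flip (i : ι) (F : (ι → Bool) → ℝ) (h : ∀ x, F (flip i x) = -F x) :
    𝔼 x, F x = 0 := by
  have : 𝔼 x, F x = 𝔼 x, F (flip i x) :=
    (Fintype.expect_equiv (Function.Involutive.toPerm (flip i) (flip_flip i)) _ _
      fun _ => rfl).symm
  simp only [h, Finset.expect_neg_distrib] at this
  linarith

/-- If the sets differ, flipping a coordinate that lies in exactly one of them negates the product.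
-/
lemma expect_mono_mul_mono (S T : Finset ι) :
    𝔼 x, mono S (vertex x) * mono T (vertex x) = if S = T then 1 else 0 := by
  split_ifs with h
  · subst h
    have : ∀ x : ι → Bool, mono S (vertex x) * mono S (vertex x) = 1 := fun x => by
      rw [← abs_mul_abs_self, abs_mono_vertex, one_mul]
    simp only [this]
    exact Fintype.expect_one
  · obtain ⟨i, hi⟩ : ∃ i, ¬(i ∈ S ↔ i ∈ T) := by
      by_contra! hc
      exact h (Finset.ext hc)
    refine expect_eq_zero_of_flip i _ fun x => ?_
    by_cases hS : i ∈ S <;> by_cases hT : i ∈ T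
    · exact absurd (iff_of_true hS hT) hi
    · rw [mono_flip_of_mem hS, mono_flip_of_notMem hT, neg_mul]
    · rw [mono_flip_of_notMem hS, mono_flip_of_mem hT, mul_neg]
    · exact absurd (iff_of_false hS hT) hi

lemma expect_polyOn_sq (s : Finset ι) (a : Finset ι → ℝ) :
    𝔼 x, polyOn s a (vertex x) ^ 2 = ∑ S ∈ s.powerset, a S ^ 2 := by
  have : ∀ x : ι → Bool, polyOn s a (vertex x) ^ 2 =
      ∑ S ∈ s.powerset, ∑ T ∈ s.powerset,
        a S * a T * (mono S (vertex x) * mono T (vertex x)) := by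
    intro x
    rw [pow_two, polyOn, Finset.sum_mul_sum]
    exact Finset.sum_congr rfl fun S _ => Finset.sum_congr rfl fun T _ => by ring
  simp only [this, Finset.expect_sum_comm, ← Finset.mul_expect, expect_mono_mul_mono]
  refine Finset.sum_congr rfl fun S hS => ?_
  simp only [mul_ite, mul_one, mul_zero, Finset.sum_ite_eq, hS, if_true, pow_two]

/-- Bonami's hypercontractive `(2,4)` inequality on the discrete cube. -/
lemma bonami (s : Finset ι) : ∀ a : Finset ι → ℝ,
    𝔼 x, polyOn s a (vertex x) ^ 4 ≤ (∑ S ∈ s.powerset, 3 ^ #S * a S ^ 2) ^ 2 := by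
  induction s using Finset.induction_on with
  | empty =>
    intro a
    simp only [polyOn, mono, Finset.powerset_empty, Finset.sum_singleton, Finset.prod_empty,
      mul_one, Finset.card_empty, pow_zero, one_mul]
    rw [Fintype.expect_const]
    exact le_of_eq (by ring)
  | insert i s hi ih =>
    intro a
    set g : (ι → Bool) → ℝ := fun x => polyOn s a (vertex x) with hg
    set h : (ι → Bool) → ℝ := fun x => polyOn s (fun S => a (insert i S)) (vertex x) with hh
    set G := ∑ S ∈ s.powerset, 3 ^ #S * a S ^ 2 with hG
    set H := ∑ S ∈ s.powerset, 3 ^ #S * a (insert i S) ^ 2 with hH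
    have hG0 : 0 ≤ G := Finset.sum_nonneg fun _ _ => by positivity
    have hH0 : 0 ≤ H := Finset.sum_nonneg fun _ _ => by positivity
    have hsum : ∑ S ∈ (insert i s).powerset, 3 ^ #S * a S ^ 2 = G + 3 * H := by
      rw [Finset.sum_powerset_insert hi, hG, hH, Finset.mul_sum]
      congr 1
      refine Finset.sum_congr rfl fun S hS => ?_
      rw [Finset.card_insert_of_notMem fun h => hi (Finset.mem_powerset.1 hS h)]
      ring
    -- Write the polynomial as `g + y_i h`, with `g` and `h` free of `y_i`. Since `y_i² = 1`, the
    -- fourth power splits into a part free of `y_i` and a multiple of `y_i`, which averages to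
    -- zero.
    have hexp : ∀ x : ι → Bool, polyOn (insert i s) a (vertex x) ^ 4 =
        (g x ^ 4 + 6 * (g x ^ 2 * h x ^ 2) + h x ^ 4) +
          vertex x i * (4 * g x ^ 3 * h x + 4 * g x * h x ^ 3) := by
      intro x
      have h2 : vertex x i ^ 2 = 1 := by rw [pow_two]; exact sgn_mul_self _
      have h3 : vertex x i ^ 3 = vertex x i := by rw [pow_succ, h2, one_mul]
      have h4 : vertex x i ^ 4 = 1 := by rw [pow_succ, h3, ← pow_two, h2]
      rw [polyOn_insert hi]
      change (g x + vertex x i * h x) ^ 4 = _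
      linear_combination (6 * g x ^ 2 * h x ^ 2) * h2 + (4 * g x * h x ^ 3) * h3 + h x ^ 4 * h4
    have hodd : 𝔼 x, vertex x i * (4 * g x ^ 3 * h x + 4 * g x * h x ^ 3) = 0 := by
      refine expect_eq_zero_of_flip i _ fun x => ?_
      simp only [hg, hh, polyOn_flip hi, vertex_flip_self]
      ring
    have e1 := ih a
    have e2 := ih fun S => a (insert i S)
    -- By Cauchy–Schwarz and both induction hypotheses; the induction then closes because `G² + 6GH
    -- + H² ≤ (G + 3H)²`.
    have e3 : 𝔼 x, g x ^ 2 * h x ^ 2 ≤ G * H := by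
      have cs := Finset.expect_mul_sq_le_sq_mul_sq univ (fun x => g x ^ 2) (fun x => h x ^ 2)
      simp only [← pow_mul] at cs
      refine abs_le_of_sq_le_sq' (a := 𝔼 x, g x ^ 2 * h x ^ 2) (cs.trans ?_) (mul_nonneg hG0 hH0) |>.2
      rw [mul_pow]
      exact mul_le_mul e1 e2 (Finset.expect_nonneg fun x _ => Even.pow_nonneg (by decide) _)
        (sq_nonneg G)
    simp only [hexp, Finset.expect_add_distrib, hodd, ← Finset.mul_expect]
    rw [hsum]
    have e1' : 𝔼 x, g x ^ 4 ≤ G ^ 2 := e1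
    have e2' : 𝔼 x, h x ^ 4 ≤ H ^ 2 := e2
    nlinarith [mul_nonneg hG0 hH0, sq_nonneg H]

/-- A bound of the second moment by the first one, from Bonami's inequality. -/
lemma secondMoment_le {s : Finset ι} {m : ℕ} (a : Finset ι → ℝ) (ha : ∀ S, m < #S → a S = 0) :
    ∑ S ∈ s.powerset, a S ^ 2 ≤ 9 ^ m * (𝔼 x, |polyOn s a (vertex x)|) ^ 2 := by
  set V := ∑ S ∈ s.powerset, a S ^ 2 with hV
  set g : (ι → Bool) → ℝ := fun x => |polyOn s a (vertex x)| with hg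
  have hV0 : 0 ≤ V := Finset.sum_nonneg fun _ _ => by positivity
  have m2 : 𝔼 x, g x ^ 2 = V := by simpa [hg] using expect_polyOn_sq s a
  have m4 : 𝔼 x, g x ^ 4 ≤ (3 ^ m * V) ^ 2 := by
    have : 𝔼 x, g x ^ 4 = 𝔼 x, polyOn s a (vertex x) ^ 4 := by
      refine Finset.expect_congr rfl fun x _ => ?_
      exact Even.pow_abs (by decide) _
    rw [this]
    refine (bonami s a).trans ?_
    refine pow_le_pow_left₀ (Finset.sum_nonneg fun _ _ => by positivity) ?_ 2
    rw [hV, Finset.mul_sum]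
    refine Finset.sum_le_sum fun S _ => ?_
    by_cases h : m < #S
    · simp [ha S h]
    · gcongr
      · norm_num
      · omega
  have m1 : 0 ≤ 𝔼 x, g x := Finset.expect_nonneg fun _ _ => abs_nonneg _
  have m3 : 0 ≤ 𝔼 x, g x ^ 3 := Finset.expect_nonneg fun _ _ => by positivity
  rcases hV0.eq_or_lt with h0 | hpos
  · rw [← h0]; positivity
  -- The second moment is interpolated between the first and the fourth by two uses of
  -- Cauchy–Schwarz, through the third moment; the fourth is at most `9^m V²`.
  have c1 : V ^ 2 ≤ (𝔼 x, g x) * 𝔼 x, g x ^ 3 := by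
    have cs := Finset.expect_mul_sq_le_sq_mul_sq univ (fun x => √(g x)) (fun x => g x * √(g x))
    have i1 : ∀ x, √(g x) * (g x * √(g x)) = g x ^ 2 := fun x => by
      have := Real.mul_self_sqrt (abs_nonneg (polyOn s a (vertex x)))
      change √(g x) * √(g x) = g x at this
      linear_combination (g x) * this
    have i2 : ∀ x, √(g x) ^ 2 = g x := fun x => Real.sq_sqrt (abs_nonneg _)
    have i3 : ∀ x, (g x * √(g x)) ^ 2 = g x ^ 3 := fun x => by rw [mul_pow, i2]; ring
    simpa only [i1, i2, i3, m2] using cs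
  have c2 : (𝔼 x, g x ^ 3) ^ 2 ≤ V * (3 ^ m * V) ^ 2 := by
    have cs := Finset.expect_mul_sq_le_sq_mul_sq univ g (fun x => g x ^ 2)
    have i1 : ∀ x, g x * g x ^ 2 = g x ^ 3 := fun x => by ring
    simp only [i1, m2, ← pow_mul] at cs
    exact cs.trans (mul_le_mul_of_nonneg_left m4 hV0)
  have c3 : V ^ 4 ≤ (𝔼 x, g x) ^ 2 * (V * (3 ^ m * V) ^ 2) :=
    calc V ^ 4 = (V ^ 2) ^ 2 := by ring
      _ ≤ ((𝔼 x, g x) * 𝔼 x, g x ^ 3) ^ 2 := by gcongr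
      _ = (𝔼 x, g x) ^ 2 * (𝔼 x, g x ^ 3) ^ 2 := by ring
      _ ≤ _ := by gcongr
  have e9 : (9 : ℝ) ^ m = (3 ^ m) ^ 2 := by rw [← pow_mul, mul_comm, pow_mul]; norm_num
  rw [e9]
  refine le_of_mul_le_mul_right ?_ (pow_pos hpos 3)
  calc V * V ^ 3 = V ^ 4 := by ring
    _ ≤ _ := c3
    _ = _ := by ring

end Cube

end

/-! ### Influences of bounded low-degree polynomials, and thresholding -/

noncomputable section

namespace Cube

open Finset BigOperators

/-- The linear coefficient of a polynomial of degree at most `d` that is bounded on `[-1,1]`. -/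
lemma abs_linear_coeff_le (d : ℕ) : ∀ (c : ℕ → ℝ) (M : ℝ),
    (∀ r : ℝ, |r| ≤ 1 → |∑ m ∈ range (d + 2), c m * r ^ m| ≤ M) → |c 1| ≤ 5 ^ d * M := by
  induction d with
  | zero =>
    intro c M h
    have h1 := h 1 (by simp)
    have h2 := h (-1) (by simp)
    simp only [Finset.sum_range_succ, Finset.sum_range_zero] at h1 h2
    rw [abs_le] at h1 h2 ⊢
    constructor <;> norm_num at h1 h2 ⊢ <;> linarith
  | succ d ih =>
    intro c M h
    have hM : 0 ≤ M := (abs_nonneg _).trans (h 0 (by simp))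
    have hk : (2 : ℝ) ≤ 2 ^ (d + 1) := by
      rw [pow_succ]
      have : (1 : ℝ) ≤ 2 ^ d := one_le_pow₀ (by norm_num)
      linarith
    set k := d + 2 with hkd
    -- The combination `2^k p(r/2) - p(r)` cancels the top coefficient, multiplies the linear one by
    -- `2^(k-1) - 1`, and is bounded by `(2^k + 1) M`. The quotient of these factors is at most 5,
    -- attained at `k = 2`.
    have key := ih (fun m => (2 ^ k / 2 ^ m - 1) * c m) ((2 ^ k + 1) * M) fun r hr => by
      have e1 := h r hr
      have e2 := h (r / 2) (by rw [abs_div, abs_two]; linarith [abs_nonneg r])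
      rw [Finset.sum_range_succ] at e1 e2
      have e3 : ∑ m ∈ range k, (2 ^ k / 2 ^ m - 1) * c m * r ^ m =
          2 ^ k * (∑ m ∈ range k, c m * (r / 2) ^ m + c k * (r / 2) ^ k) -
            (∑ m ∈ range k, c m * r ^ m + c k * r ^ k) := by
        have : (2 : ℝ) ^ k * (c k * (r / 2) ^ k) = c k * r ^ k := by
          rw [div_pow]; field_simp
        rw [mul_add, this, add_sub_add_right_eq_sub, Finset.mul_sum, ← Finset.sum_sub_distrib]
        refine Finset.sum_congr rfl fun m _ => ?_
        rw [div_pow]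
        field_simp
      rw [e3]
      refine (abs_sub _ _).trans ?_
      rw [abs_mul, abs_of_nonneg (by positivity : (0 : ℝ) ≤ 2 ^ k)]
      have := mul_le_mul_of_nonneg_left e2 (by positivity : (0 : ℝ) ≤ 2 ^ k)
      linarith
    have e : (2 : ℝ) ^ k / 2 ^ 1 - 1 = 2 ^ (d + 1) - 1 := by
      rw [hkd, pow_succ]; norm_num
    simp only [e] at key
    rw [abs_mul, abs_of_nonneg (by linarith)] at key
    have e2 : (2 : ℝ) ^ k + 1 ≤ 5 * (2 ^ (d + 1) - 1) := by
      rw [hkd, pow_succ]; linarith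
    have h5 : 0 ≤ (5 : ℝ) ^ d * M := by positivity
    have : ((2 : ℝ) ^ (d + 1) - 1) * |c 1| ≤ (2 ^ (d + 1) - 1) * (5 ^ (d + 1) * M) := by
      refine key.trans ?_
      rw [pow_succ 5]
      nlinarith
    exact le_of_mul_le_mul_left this (by linarith)

lemma abs_coeff_one_le {d : ℕ} (hd : 1 ≤ d) {q : Polynomial ℝ} (hq : q.natDegree ≤ d) {M : ℝ}
    (h : ∀ r : ℝ, |r| ≤ 1 → |q.eval r| ≤ M) : |q.coeff 1| ≤ 5 ^ d * M := by
  have hM : 0 ≤ M := (abs_nonneg _).trans (h 0 (by simp))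
  obtain ⟨e, rfl⟩ : ∃ e, d = e + 1 := ⟨d - 1, by omega⟩
  have := abs_linear_coeff_le e q.coeff M fun r hr => by
    rw [← Polynomial.eval_eq_sum_range' (by omega)]
    exact h r hr
  refine this.trans ?_
  gcongr
  · norm_num
  · omega

variable {ι : Type*} [DecidableEq ι]

/-- A nonempty set of at most `d` elements is the range of a function on `Fin d`; the empty set is
counted apart. -/
lemma card_powerset_filter_card_le (H : Finset ι) (d : ℕ) :
    #{S ∈ H.powerset | #S ≤ d} ≤ 1 + #H ^ d := by
  have hsub : {S ∈ H.powerset | #S ≤ d} ⊆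
      insert ∅ ((univ : Finset (Fin d → H)).image fun f => univ.image fun k => (f k : ι)) := by
    intro S hS
    obtain ⟨hS1, hS2⟩ := Finset.mem_filter.1 hS
    rw [Finset.mem_powerset] at hS1
    rcases S.eq_empty_or_nonempty with rfl | hne
    · simp
    refine Finset.mem_insert_of_mem (Finset.mem_image.2 ?_)
    have : Nonempty S := hne.to_subtype
    obtain ⟨g, hg⟩ : ∃ g : Fin d → S, Function.Surjective g := by
      have e : S ≃ Fin #S := S.equivFin
      have hc : 0 < #S := hne.card_pos
      have : Nonempty (Fin #S) := ⟨⟨0, hc⟩⟩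
      refine ⟨fun k => e.symm (Function.invFun (Fin.castLE hS2) k),
        e.symm.surjective.comp (Function.invFun_surjective (Fin.castLE_injective hS2))⟩
    refine ⟨fun k => ⟨g k, hS1 (g k).2⟩, Finset.mem_univ _, ?_⟩
    ext i
    simp only [Finset.mem_image, Finset.mem_univ, true_and]
    constructor
    · rintro ⟨k, rfl⟩; exact (g k).2
    · intro hi
      obtain ⟨k, hk⟩ := hg ⟨i, hi⟩
      exact ⟨k, by rw [hk]⟩
  refine (Finset.card_le_card hsub).trans ((Finset.card_insert_le _ _).trans ?_)
  rw [add_comm]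
  gcongr
  refine Finset.card_image_le.trans ?_
  simp

variable [Fintype ι]

/-- The multilinear polynomial with coefficients `a` in all the variables. -/
def poly (a : Finset ι → ℝ) (y : ι → ℝ) : ℝ := ∑ S, a S * mono S y

/-- The partial derivative of `poly a` in the direction `i`. -/
def deriv (a : Finset ι → ℝ) (i : ι) (y : ι → ℝ) : ℝ :=
  ∑ S with i ∈ S, a S * mono (S.erase i) y

open Polynomial in
-- Restricted to the line `u + r v`, the polynomial has degree at most `d` in `r`, and its linear
-- coefficient is the directional derivative at `u`.
lemma abs_directional_deriv_le {d : ℕ} (hd : 1 ≤ d) {a : Finset ι → ℝ}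
    (ha : ∀ S, d < #S → a S = 0) {t : ℝ} (u v : ι → ℝ)
    (h : ∀ r : ℝ, |r| ≤ 1 → |poly a (fun i => u i + r * v i)| ≤ t) :
    |∑ i, v i * deriv a i u| ≤ 5 ^ d * t := by
  set q : ℝ[X] := ∑ S, C (a S) * ∏ i ∈ S, (C (u i) + C (v i) * X) with hq
  have hev : ∀ r, q.eval r = poly a (fun i => u i + r * v i) := fun r => by
    simp only [hq, eval_finsetSum, eval_mul, eval_C, eval_prod, eval_add, eval_X, poly, mono]
    simp only [mul_comm]
  have hdeg : q.natDegree ≤ d := by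
    refine natDegree_sum_le_of_forall_le _ _ fun S _ => ?_
    by_cases hS : d < #S
    · simp [ha S hS]
    · refine (natDegree_C_mul_le _ _).trans ((natDegree_prod_le _ _).trans ?_)
      refine (Finset.sum_le_card_nsmul _ _ 1 fun i _ => ?_).trans (by simpa using hS)
      rw [add_comm]
      exact natDegree_linear_le
  have hc : q.coeff 1 = ∑ i, v i * deriv a i u := by
    have : q.coeff 1 = (derivative q).eval 0 := by
      rw [← coeff_zero_eq_eval_zero, coeff_derivative]; norm_num
    rw [this, hq]
    simp only [derivative_sum, derivative_C_mul, eval_finsetSum, eval_mul, eval_C,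
      derivative_prod_finset, eval_prod, eval_add, eval_X, mul_zero, add_zero,
      derivative_add, derivative_C, derivative_X, mul_one, zero_add]
    simp only [deriv, mono, Finset.mul_sum, Finset.sum_filter]
    rw [Finset.sum_comm]
    refine Finset.sum_congr rfl fun S _ => ?_
    simp only [mul_ite, mul_zero]
    rw [← Finset.sum_filter]
    refine Finset.sum_congr (by ext; simp) fun i _ => by ring
  rw [← hc]
  exact abs_coeff_one_le hd hdeg fun r hr => by rw [hev]; exact h r hr

/-- From the interior point `x/2` there is room to move by 1/2 in every coordinate. Moving along
half the signs of the partial derivatives adds up all their absolute values in one directional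
derivative. -/
lemma sum_abs_deriv_le {d : ℕ} (hd : 1 ≤ d) {a : Finset ι → ℝ}
    (ha : ∀ S, d < #S → a S = 0) {t : ℝ}
    (h : ∀ y : ι → ℝ, (∀ i, |y i| ≤ 1) → |poly a y| ≤ t) (x : ι → Bool) :
    ∑ i, |deriv a i (fun j => vertex x j / 2)| ≤ 2 * 5 ^ d * t := by
  set u : ι → ℝ := fun j => vertex x j / 2 with hu
  set v : ι → ℝ := fun i => (SignType.sign (deriv a i u) : ℝ) / 2 with hv
  have key := abs_directional_deriv_le hd ha u v fun r hr => h _ fun i => by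
    refine (abs_add_le _ _).trans ?_
    have h1 : |u i| = 1 / 2 := by
      rw [hu, abs_div, abs_two]; simp only [vertex, abs_sgn]
    have h2 : |v i| ≤ 1 / 2 := by
      rw [hv, abs_div, abs_two]
      rcases SignType.trichotomy (SignType.sign (deriv a i u)) with h | h | h <;> simp [h]
    rw [abs_mul, h1]
    nlinarith [abs_nonneg r, abs_nonneg (v i)]
  have e : ∑ i, v i * deriv a i u = (∑ i, |deriv a i u|) / 2 := by
    rw [Finset.sum_div]
    refine Finset.sum_congr rfl fun i _ => ?_
    rw [hv, div_mul_eq_mul_div, sign_mul_self]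
  rw [e] at key
  linarith [le_abs_self ((∑ i, |deriv a i u|) / 2)]

/-- Halving the vertex only damps each coefficient by a power of 2, so the derivative at an interior
point is again a polynomial on the vertices, to which the moment comparison applies. -/
lemma deriv_half_vertex (a : Finset ι → ℝ) (i : ι) (x : ι → Bool) :
    deriv a i (fun j => vertex x j / 2) =
      polyOn (univ.erase i) (fun S => if i ∈ S then 0 else a (insert i S) / 2 ^ #S)
        (vertex x) := by
  rw [deriv, polyOn]
  symm
  refine Finset.sum_nbij' (fun S => insert i S) (fun S => S.erase i) ?_ ?_ ?_ ?_ ?_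
  · intro S _; simp
  · intro S _
    exact Finset.mem_powerset.2 (Finset.erase_subset_erase _ (Finset.subset_univ _))
  · intro S hS
    exact Finset.erase_insert fun h => by simpa using Finset.mem_powerset.1 hS h
  · intro S hS
    exact Finset.insert_erase (by simpa using hS)
  · intro S hS
    have hi : i ∉ S := fun h => by simpa using Finset.mem_powerset.1 hS h
    rw [if_neg hi, Finset.erase_insert hi]
    simp only [mono, Finset.prod_div_distrib, Finset.prod_const]
    ring

/-- The square root of the influence of the variable `i`. -/
def infl (a : Finset ι → ℝ) (i : ι) : ℝ := √(∑ S with i ∈ S, a S ^ 2)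

lemma infl_nonneg (a : Finset ι → ℝ) (i : ι) : 0 ≤ infl a i := Real.sqrt_nonneg _

lemma infl_sq (a : Finset ι → ℝ) (i : ι) : infl a i ^ 2 = ∑ S with i ∈ S, a S ^ 2 :=
  Real.sq_sqrt (Finset.sum_nonneg fun _ _ => sq_nonneg _)

/-- A factor `3^d` comes from comparing second and first moments, and `2^d` from undoing the damping
of the coefficients at `x/2`. -/
lemma infl_le_expect {d : ℕ} {a : Finset ι → ℝ} (ha : ∀ S, d < #S → a S = 0) (i : ι) :
    infl a i ≤ 6 ^ d * 𝔼 x, |deriv a i (fun j => vertex x j / 2)| := by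
  simp only [deriv_half_vertex]
  set b : Finset ι → ℝ := fun S => if i ∈ S then 0 else a (insert i S) / 2 ^ #S with hb
  have hb0 : ∀ S, d < #S → b S = 0 := fun S hS => by
    simp only [hb]
    split_ifs with h
    · rfl
    · rw [ha _ (hS.trans_le (Finset.card_le_card (Finset.subset_insert _ _))), zero_div]
  have h1 := secondMoment_le (s := univ.erase i) b hb0
  have h2 : infl a i ^ 2 ≤ 4 ^ d * ∑ S ∈ (univ.erase i).powerset, b S ^ 2 := by
    rw [infl_sq, Finset.mul_sum]
    refine le_of_eq_of_le (Finset.sum_nbij' (t := (univ.erase i).powerset)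
      (g := fun S => a (insert i S) ^ 2) (fun S => S.erase i) (fun S => insert i S)
      ?_ ?_ ?_ ?_ ?_) (Finset.sum_le_sum fun S hS => ?_)
    · intro S _
      exact Finset.mem_powerset.2 (Finset.erase_subset_erase _ (Finset.subset_univ _))
    · intro S _; simp
    · intro S hS
      exact Finset.insert_erase (by simpa using hS)
    · intro S hS
      exact Finset.erase_insert fun h => by simpa using Finset.mem_powerset.1 hS h
    · intro S hS
      rw [Finset.insert_erase (by simpa using hS)]
    · have hi : i ∉ S := fun h => by simpa using Finset.mem_powerset.1 hS h
      by_cases hc : d < #S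
      · rw [ha _ (hc.trans_le (Finset.card_le_card (Finset.subset_insert _ _)))]
        rw [zero_pow two_ne_zero]
        positivity
      · simp only [hb, if_neg hi, div_pow]
        rw [← pow_mul, mul_comm _ 2, pow_mul, ← mul_div_assoc, le_div_iff₀ (by positivity),
          mul_comm]
        norm_num
        gcongr
        · norm_num
        · omega
  have hE : 0 ≤ 𝔼 x : ι → Bool, |polyOn (univ.erase i) b (vertex x)| :=
    Finset.expect_nonneg fun _ _ => abs_nonneg _
  refine le_of_sq_le_sq ?_ (by positivity)
  calc infl a i ^ 2 ≤ _ := h2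
    _ ≤ 4 ^ d * (9 ^ d * (𝔼 x, |polyOn (univ.erase i) b (vertex x)|) ^ 2) := by gcongr
    _ = _ := by
      rw [mul_pow, ← mul_assoc, ← mul_pow, ← pow_mul, mul_comm d 2, pow_mul]
      norm_num

/-- A polynomial of degree at most `d` bounded by `t` on the cube has total root influence at
most `2 · 30^d t`. -/
lemma sum_infl_le {d : ℕ} (hd : 1 ≤ d) {a : Finset ι → ℝ}
    (ha : ∀ S, d < #S → a S = 0) {t : ℝ}
    (h : ∀ y : ι → ℝ, (∀ i, |y i| ≤ 1) → |poly a y| ≤ t) :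
    ∑ i, infl a i ≤ 2 * 30 ^ d * t := by
  calc ∑ i, infl a i ≤ ∑ i, 6 ^ d * 𝔼 x, |deriv a i (fun j => vertex x j / 2)| :=
        Finset.sum_le_sum fun i _ => infl_le_expect ha i
    _ = 6 ^ d * 𝔼 x, ∑ i, |deriv a i (fun j => vertex x j / 2)| := by
        rw [← Finset.mul_sum, Finset.expect_sum_comm]
    _ ≤ 6 ^ d * (2 * 5 ^ d * t) := by
        gcongr
        exact Finset.expect_le univ_nonempty fun x _ => sum_abs_deriv_le hd ha h x
    _ = _ := by
        rw [show (30 : ℝ) = 6 * 5 by norm_num, mul_pow]; ring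

/-- Heavy and light variables: the truncated energy of a polynomial in terms of its total root
influence. -/
lemma sum_min_sq_le {d : ℕ} {a : Finset ι → ℝ}
    (ha : ∀ S, d < #S → a S = 0) {B τ b : ℝ} (hτ : 0 < τ) (hB : ∑ i, infl a i ≤ B) :
    ∑ S, min (a S ^ 2) (b ^ 2) ≤ τ * B + b ^ 2 * (1 + (B / τ) ^ d) := by
  -- The heavy variables: there are at most `B / τ` of them, by Markov's inequality.
  set H : Finset ι := univ.filter fun i => τ < infl a i with hH
  have hHc : (#H : ℝ) ≤ B / τ := by
    rw [le_div_iff₀ hτ]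
    calc (#H : ℝ) * τ = ∑ i ∈ H, τ := by simp
      _ ≤ ∑ i ∈ H, infl a i := Finset.sum_le_sum fun i hi => (Finset.mem_filter.1 hi).2.le
      _ ≤ ∑ i, infl a i :=
        Finset.sum_le_sum_of_subset_of_nonneg (Finset.subset_univ _) fun _ _ _ => infl_nonneg _ _
      _ ≤ B := hB
  -- Such a set contains a light variable, so its energy is counted in a light influence, and `infl²
  -- ≤ τ · infl` there.
  have h1 : ∑ S with ¬ S ⊆ H, min (a S ^ 2) (b ^ 2) ≤ τ * B := by
    calc ∑ S with ¬ S ⊆ H, min (a S ^ 2) (b ^ 2) ≤ ∑ S with ¬ S ⊆ H, a S ^ 2 :=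
          Finset.sum_le_sum fun _ _ => min_le_left _ _
      _ ≤ ∑ S, ∑ i ∈ Hᶜ, if i ∈ S then a S ^ 2 else 0 := by
          rw [Finset.sum_filter]
          refine Finset.sum_le_sum fun S _ => ?_
          have hnn : ∀ i ∈ Hᶜ, 0 ≤ if i ∈ S then a S ^ 2 else 0 := fun i _ => by positivity
          split_ifs with hS
          · exact Finset.sum_nonneg hnn
          · obtain ⟨i, hi, hi'⟩ := Finset.not_subset.1 hS
            refine le_of_eq_of_le ?_ (Finset.single_le_sum hnn (Finset.mem_compl.2 hi'))
            rw [if_pos hi]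
      _ = ∑ i ∈ Hᶜ, ∑ S with i ∈ S, a S ^ 2 := by
          rw [Finset.sum_comm]
          exact Finset.sum_congr rfl fun i _ => (Finset.sum_filter _ _).symm
      _ ≤ ∑ i ∈ Hᶜ, τ * infl a i := by
          refine Finset.sum_le_sum fun i hi => ?_
          rw [← infl_sq, pow_two]
          have : infl a i ≤ τ := by simpa [hH] using hi
          exact mul_le_mul_of_nonneg_right this (infl_nonneg _ _)
      _ ≤ ∑ i, τ * infl a i :=
          Finset.sum_le_sum_of_subset_of_nonneg (Finset.subset_univ _) fun _ _ _ =>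
            mul_nonneg hτ.le (infl_nonneg _ _)
      _ ≤ τ * B := by rw [← Finset.mul_sum]; gcongr
  have h2 : ∑ S with S ⊆ H, min (a S ^ 2) (b ^ 2) ≤ b ^ 2 * (1 + (B / τ) ^ d) := by
    calc ∑ S with S ⊆ H, min (a S ^ 2) (b ^ 2)
        = ∑ S ∈ {S ∈ H.powerset | #S ≤ d}, min (a S ^ 2) (b ^ 2) := by
          symm
          refine Finset.sum_subset (fun S hS => ?_) fun S hS hS' => ?_
          · simp only [Finset.mem_filter, Finset.mem_powerset] at hS
            simp [hS.1]
          · simp only [Finset.mem_filter, Finset.mem_powerset, Finset.mem_univ, true_and] at hS hS'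
            rw [ha S (by by_contra hc; exact hS' ⟨hS, by omega⟩), zero_pow two_ne_zero]
            exact min_eq_left (sq_nonneg _)
      _ ≤ ∑ S ∈ {S ∈ H.powerset | #S ≤ d}, b ^ 2 :=
          Finset.sum_le_sum fun _ _ => min_le_right _ _
      _ = b ^ 2 * #{S ∈ H.powerset | #S ≤ d} := by
          rw [Finset.sum_const, nsmul_eq_mul, mul_comm]
      _ ≤ b ^ 2 * (1 + (#H : ℝ) ^ d) := by
          gcongr
          exact_mod_cast card_powerset_filter_card_le H d
      _ ≤ _ := by gcongr
  rw [← Finset.sum_filter_add_sum_filter_not univ (fun S => S ⊆ H)]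
  linarith

/-- Discard the coefficients below the threshold. -/
def threshold (b v : ℝ) : ℝ := if 2 * b ≤ |v| then v else 0

/-- A kept value has `|u| ≥ b` and error at most `b`; a discarded one has `|u| ≤ 3b` and error
`|u|`. In both cases the error is at most `3 min(|u|, b)`. -/
lemma threshold_sub_sq_le {b u v : ℝ} (h : |v - u| ≤ b) :
    (u - threshold b v) ^ 2 ≤ 9 * min (u ^ 2) (b ^ 2) := by
  have hb : 0 ≤ b := (abs_nonneg _).trans h
  have h1 : |v| ≤ |u| + b := by
    have := abs_sub_abs_le_abs_sub v u
    linarith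
  have h2 : |u| ≤ |v| + b := by
    have := abs_sub_abs_le_abs_sub u v
    rw [abs_sub_comm] at this
    linarith
  rw [← sq_abs u, threshold, mul_min_of_nonneg _ _ (by norm_num : (0 : ℝ) ≤ 9)]
  split_ifs with hc
  · have e : (u - v) ^ 2 ≤ b ^ 2 := by
      rw [← sq_abs, abs_sub_comm]; gcongr
    refine le_min ?_ ?_ <;> nlinarith [sq_nonneg b, abs_nonneg u]
  · rw [sub_zero, ← sq_abs u]
    refine le_min ?_ ?_ <;> nlinarith [abs_nonneg u]

end Cube

end

/-! ### Concentration of empirical Fourier coefficients -/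

noncomputable section

namespace Cube

open Finset BigOperators

/-- A one-sided Chernoff bound for independent uniform draws from a finite set. -/
lemma card_tuples_sum_ge_le {X : Type*} [Fintype X] [Nonempty X] (s : ℕ) (Y : X → ℝ) {M β : ℝ}
    (hM : 0 < M) (hY : ∀ x, |Y x| ≤ M) (hY0 : 𝔼 x, Y x = 0) (hβ : 0 ≤ β) (hβM : β ≤ 2 * M) :
    (#{x : Fin s → X | s * β ≤ ∑ k, Y (x k)} : ℝ) ≤
      Real.exp (-(s * β ^ 2 / (4 * M ^ 2))) * (Fintype.card X : ℝ) ^ s := by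
  -- The minimiser of `l² M² - l β`. The condition `β ≤ 2M` makes `l M ≤ 1`, the range in which `exp
  -- x ≤ 1 + x + x²` is used.
  set l := β / (2 * M ^ 2) with hl
  have hl0 : 0 ≤ l := by positivity
  have hlM : l * M ≤ 1 := by
    rw [hl, div_mul_eq_mul_div, div_le_one (by positivity)]
    nlinarith
  have h1 : 𝔼 x, Real.exp (l * Y x) ≤ Real.exp (l ^ 2 * M ^ 2) := by
    calc 𝔼 x, Real.exp (l * Y x) ≤ 𝔼 x, (1 + l ^ 2 * M ^ 2 + l * Y x) := by
          refine Finset.expect_le_expect fun x _ => ?_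
          have hx : |l * Y x| ≤ l * M := by
            rw [abs_mul, abs_of_nonneg hl0]
            exact mul_le_mul_of_nonneg_left (hY x) hl0
          have := (abs_le.1 (Real.abs_exp_sub_one_sub_id_le (hx.trans hlM))).2
          have h2 : (l * Y x) ^ 2 ≤ l ^ 2 * M ^ 2 := by
            rw [← mul_pow, ← sq_abs]
            gcongr
          linarith
      _ = l ^ 2 * M ^ 2 + 1 := by
          rw [Finset.expect_add_distrib, ← Finset.mul_expect, hY0, Fintype.expect_const]; ring
      _ ≤ _ := Real.add_one_le_exp _
  have h2 : ∑ x, Real.exp (l * Y x) ≤ Fintype.card X * Real.exp (l ^ 2 * M ^ 2) := by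
    rw [← Fintype.card_mul_expect]
    gcongr
  have h3 : ∑ x : Fin s → X, Real.exp (l * ∑ k, Y (x k)) ≤
      (Fintype.card X * Real.exp (l ^ 2 * M ^ 2)) ^ s := by
    calc ∑ x : Fin s → X, Real.exp (l * ∑ k, Y (x k))
        = ∑ x : Fin s → X, ∏ k, Real.exp (l * Y (x k)) := by
          simp only [Finset.mul_sum, Real.exp_sum]
      _ = (∑ x, Real.exp (l * Y x)) ^ s := by
          rw [Fintype.sum_pow]
      _ ≤ _ := pow_le_pow_left₀ (Finset.sum_nonneg fun _ _ => (Real.exp_pos _).le) h2 s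
  have h4 : (#{x : Fin s → X | s * β ≤ ∑ k, Y (x k)} : ℝ) * Real.exp (l * (s * β)) ≤
      (Fintype.card X * Real.exp (l ^ 2 * M ^ 2)) ^ s := by
    refine le_trans ?_ h3
    rw [← nsmul_eq_mul, ← Finset.sum_const]
    refine (Finset.sum_le_sum fun x hx => ?_).trans
      (Finset.sum_le_sum_of_subset_of_nonneg (Finset.filter_subset _ _) fun _ _ _ =>
        (Real.exp_pos _).le)
    exact Real.exp_le_exp.2 (mul_le_mul_of_nonneg_left (Finset.mem_filter.1 hx).2 hl0)
  rw [← le_div_iff₀ (Real.exp_pos _)] at h4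
  refine h4.trans (le_of_eq ?_)
  rw [mul_pow, ← Real.exp_nat_mul, mul_div_assoc, ← Real.exp_sub, mul_comm]
  congr 2
  rw [hl]
  field_simp
  ring

variable {ι : Type*} [DecidableEq ι] [Fintype ι]

lemma expect_poly_mul_mono (a : Finset ι → ℝ) (S : Finset ι) :
    𝔼 x, poly a (vertex x) * mono S (vertex x) = a S := by
  simp only [poly, Finset.sum_mul, mul_assoc, Finset.expect_sum_comm, ← Finset.mul_expect,
    expect_mono_mul_mono]
  simp

/-- The empirical Fourier coefficient. -/
def emp {s : ℕ} (S : Finset ι) (x : Fin s → ι → Bool) (v : Fin s → ℝ) : ℝ :=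
  (∑ k, v k * mono S (vertex (x k))) / s

/-- The centred samples are bounded by `2T`; the Chernoff bound is applied to both tails with `M =
2T`. -/
lemma card_emp_bad_le {a : Finset ι → ℝ} {T b : ℝ} {s : ℕ}
    (hT : ∀ x, |poly a (vertex x)| ≤ T) (hT0 : 0 < T) (hb : 0 ≤ b) (hbT : b ≤ T) (hs : 0 < s)
    (S : Finset ι) :
    (#{x : Fin s → ι → Bool | b < |emp S x (fun k => poly a (vertex (x k))) - a S|} : ℝ) ≤
      2 * (Real.exp (-(s * b ^ 2 / (16 * T ^ 2))) * (Fintype.card (ι → Bool) : ℝ) ^ s) := by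
  set Y : (ι → Bool) → ℝ := fun x => poly a (vertex x) * mono S (vertex x) - a S with hYdef
  have hYc : 𝔼 x, Y x = 0 := by
    rw [hYdef, Finset.expect_sub_distrib, expect_poly_mul_mono, Fintype.expect_const, sub_self]
  have hp : ∀ x, |poly a (vertex x) * mono S (vertex x)| ≤ T := fun x => by
    rw [abs_mul, abs_mono_vertex, mul_one]; exact hT x
  have haS : |a S| ≤ T := by
    rw [← expect_poly_mul_mono a S]
    exact (Finset.abs_expect_le _ _).trans (Finset.expect_le univ_nonempty fun x _ => hp x)
  have hY : ∀ x, |Y x| ≤ 2 * T := fun x => (abs_sub _ _).trans (by linarith [hp x])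
  have c1 := card_tuples_sum_ge_le s Y (by positivity) hY hYc hb (by linarith)
  have c2 := card_tuples_sum_ge_le s (fun x => -Y x) (M := 2 * T) (by positivity)
    (fun x => by rw [abs_neg]; exact hY x)
    (by rw [Finset.expect_neg_distrib, hYc, neg_zero]) hb (by linarith)
  have e : 4 * (2 * T) ^ 2 = 16 * T ^ 2 := by ring
  rw [e] at c1 c2
  have hs' : (0 : ℝ) < s := by exact_mod_cast hs
  have hsub : ({x : Fin s → ι → Bool | b < |emp S x (fun k => poly a (vertex (x k))) - a S|} :
      Finset (Fin s → ι → Bool)) ⊆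
      ({x | s * b ≤ ∑ k, Y (x k)} : Finset (Fin s → ι → Bool)) ∪
        ({x | s * b ≤ ∑ k, -Y (x k)} : Finset (Fin s → ι → Bool)) := by
    intro x hx
    have hx' := (Finset.mem_filter.1 hx).2
    have ee : ∑ k, Y (x k) = s * (emp S x (fun k => poly a (vertex (x k))) - a S) := by
      simp only [hYdef, emp, Finset.sum_sub_distrib, Finset.sum_const, Finset.card_univ,
        Fintype.card_fin, nsmul_eq_mul]
      field_simp
    rw [Finset.mem_union, Finset.mem_filter, Finset.mem_filter, Finset.sum_neg_distrib, ee,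
      ← mul_neg]
    rcases lt_abs.1 hx' with h | h
    · exact Or.inl ⟨Finset.mem_univ _, by gcongr⟩
    · exact Or.inr ⟨Finset.mem_univ _, by gcongr⟩
  have hc : (#{x : Fin s → ι → Bool | b < |emp S x (fun k => poly a (vertex (x k))) - a S|} : ℝ) ≤
      (#{x : Fin s → ι → Bool | s * b ≤ ∑ k, Y (x k)} : ℝ) +
        #{x : Fin s → ι → Bool | s * b ≤ ∑ k, -Y (x k)} := by
    exact_mod_cast (Finset.card_le_card hsub).trans (Finset.card_union_le _ _)
  linarith

/-- With high probability all low-degree empirical Fourier coefficients are accurate. -/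
lemma le_card_emp_good {a : Finset ι → ℝ} {T b δ : ℝ} {s d : ℕ} (hd : 1 ≤ d)
    (hT : ∀ x, |poly a (vertex x)| ≤ T) (hT0 : 0 < T) (hb : 0 < b) (hbT : b ≤ T) (hs : 0 < s)
    (hδ : 0 < δ)
    (hsδ : 16 * T ^ 2 / b ^ 2 * Real.log (2 * (Fintype.card ι + 1) ^ d / δ) ≤ s) :
    (1 - δ) * (Fintype.card (ι → Bool) : ℝ) ^ s ≤
      #{x : Fin s → ι → Bool | ∀ S : Finset ι, #S ≤ d →
        |emp S x (fun k => poly a (vertex (x k))) - a S| ≤ b} := by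
  set G : Finset (Fin s → ι → Bool) := {x | ∀ S : Finset ι, #S ≤ d →
        |emp S x (fun k => poly a (vertex (x k))) - a S| ≤ b} with hG
  set F : Finset (Finset ι) := {S ∈ univ.powerset | #S ≤ d} with hF
  set N : ℝ := ((Fintype.card ι : ℕ) : ℝ) with hN
  have hsub : Gᶜ ⊆ F.biUnion fun S =>
      {x | b < |emp S x (fun k => poly a (vertex (x k))) - a S|} := by
    intro x hx
    simp only [hG, Finset.mem_compl, Finset.mem_filter, Finset.mem_univ, true_and] at hx
    push Not at hx
    obtain ⟨S, hS, hS'⟩ := hx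
    exact Finset.mem_biUnion.2 ⟨S, by simpa [hF] using hS, by simpa using hS'⟩
  have hFc : (#F : ℝ) ≤ (N + 1) ^ d := by
    have h1 : (#F : ℝ) ≤ 1 + N ^ d := by
      have := card_powerset_filter_card_le (univ : Finset ι) d
      rw [Finset.card_univ] at this
      rw [hF, hN]
      exact_mod_cast this
    have h2 : N ^ d + 1 ^ d ≤ (N + 1) ^ d :=
      pow_add_pow_le (by positivity) zero_le_one (by omega)
    rw [one_pow] at h2
    linarith
  have hexp : 2 * (N + 1) ^ d * Real.exp (-(s * b ^ 2 / (16 * T ^ 2))) ≤ δ := by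
    have : Real.log (2 * (N + 1) ^ d / δ) ≤ s * b ^ 2 / (16 * T ^ 2) := by
      rw [div_mul_eq_mul_div, div_le_iff₀ (by positivity)] at hsδ
      rw [le_div_iff₀ (by positivity)]
      linarith
    rw [Real.log_le_iff_le_exp (by positivity), div_le_iff₀ hδ] at this
    rw [Real.exp_neg, ← div_eq_mul_inv, div_le_iff₀ (Real.exp_pos _)]
    linarith
  have hbad : (#Gᶜ : ℝ) ≤ δ * (Fintype.card (ι → Bool) : ℝ) ^ s := by
    calc (#Gᶜ : ℝ) ≤ ∑ S ∈ F,
          (#{x : Fin s → ι → Bool | b < |emp S x (fun k => poly a (vertex (x k))) - a S|} : ℝ) := by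
          exact_mod_cast (Finset.card_le_card hsub).trans Finset.card_biUnion_le
      _ ≤ ∑ S ∈ F, 2 * (Real.exp (-(s * b ^ 2 / (16 * T ^ 2))) *
            (Fintype.card (ι → Bool) : ℝ) ^ s) :=
          Finset.sum_le_sum fun S _ => card_emp_bad_le hT hT0 hb.le hbT hs S
      _ = #F * (2 * Real.exp (-(s * b ^ 2 / (16 * T ^ 2)))) *
            (Fintype.card (ι → Bool) : ℝ) ^ s := by
          rw [Finset.sum_const, nsmul_eq_mul]; ring
      _ ≤ (N + 1) ^ d * (2 * Real.exp (-(s * b ^ 2 / (16 * T ^ 2)))) *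
            (Fintype.card (ι → Bool) : ℝ) ^ s := by gcongr
      _ ≤ _ := by
          gcongr
          linarith
  have htot : (#G : ℝ) + #Gᶜ = (Fintype.card (ι → Bool) : ℝ) ^ s := by
    have := Finset.card_add_card_compl G
    rw [Fintype.card_fun, Fintype.card_fin] at this
    exact_mod_cast this
  linarith

/-- The thresholded empirical coefficients of a bounded polynomial of low degree. -/
lemma sum_sub_threshold_sq_le {d : ℕ} {a : Finset ι → ℝ}
    (ha : ∀ S, d < #S → a S = 0) {B τ b : ℝ} (hτ : 0 < τ) (hB : ∑ i, infl a i ≤ B)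
    {e : Finset ι → ℝ} (he : ∀ S, #S ≤ d → |e S - a S| ≤ b) :
    ∑ S with #S ≤ d, (a S - threshold b (e S)) ^ 2 ≤
      9 * (τ * B + b ^ 2 * (1 + (B / τ) ^ d)) := by
  calc ∑ S with #S ≤ d, (a S - threshold b (e S)) ^ 2
      ≤ ∑ S with #S ≤ d, 9 * min (a S ^ 2) (b ^ 2) :=
        Finset.sum_le_sum fun S hS => threshold_sub_sq_le (he S (Finset.mem_filter.1 hS).2)
    _ ≤ ∑ S, 9 * min (a S ^ 2) (b ^ 2) :=
        Finset.sum_le_sum_of_subset_of_nonneg (Finset.filter_subset _ _) fun _ _ _ => by positivity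
    _ ≤ _ := by
        rw [← Finset.mul_sum]
        gcongr
        exact sum_min_sq_le ha hτ hB

end Cube

end

/-! ### Orthogonality and size of the Gell-Mann matrices -/

noncomputable section

namespace Qudit

open Finset BigOperators Matrix

/-- The unnormalised diagonal of a diagonal Gell-Mann matrix. -/
def diagVec (m k : ℕ) : ℝ := if k < m then 1 else if k = m then -m else 0

lemma sum_diagVec {K m : ℕ} (hm : m < K) (g : ℕ → ℝ) :
    ∑ k : Fin K, diagVec m k * g k = ∑ k ∈ range m, g k - m * g m := by
  rw [Fin.sum_univ_eq_sum_range (fun k => diagVec m k * g k) K]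
  rw [← Finset.sum_subset (Finset.range_mono (by omega : m + 1 ≤ K)), Finset.sum_range_succ]
  · rw [Finset.sum_congr rfl (g := g)]
    · simp [diagVec]; ring
    · intro k hk
      simp [diagVec, Finset.mem_range.1 hk]
  · intro k _ hk
    have : ¬ k < m + 1 := by simpa using hk
    rw [diagVec, if_neg (by omega), if_neg (by omega), zero_mul]

lemma gmDiag_eq (K : ℕ) (i : Fin (K - 1)) : gmDiag K i =
    Matrix.diagonal fun k : Fin K =>
      ((√((K : ℝ) / (((i + 1 : ℕ) : ℝ) ^ 2 + ((i + 1 : ℕ) : ℝ))) * diagVec (i + 1) k : ℝ) : ℂ) := by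
  rw [gmDiag, ← Matrix.diagonal_smul]
  congr 1
  funext k
  simp only [Pi.smul_apply, smul_eq_mul, diagVec]
  split_ifs <;> push_cast <;> ring

lemma gellMann_isHermitian (K : ℕ) : ∀ l, (gellMann K l).IsHermitian
  | none => Matrix.isHermitian_one
  | some (Sum.inl p) => by
    simp only [gellMann, gmSym, Matrix.IsHermitian, Matrix.conjTranspose_smul,
      Matrix.conjTranspose_add, Matrix.conjTranspose_single, RCLike.star_def, Complex.conj_ofReal,
      map_one]
    rw [add_comm]
  | some (Sum.inr (Sum.inl p)) => by
    simp only [gellMann, gmAntisym, Matrix.IsHermitian, Matrix.conjTranspose_smul,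
      Matrix.conjTranspose_add, Matrix.conjTranspose_single, RCLike.star_def, Complex.conj_ofReal,
      map_neg, Complex.conj_I, neg_neg]
    rw [add_comm]
  | some (Sum.inr (Sum.inr i)) => by
    simp only [gellMann, gmDiag_eq]
    exact Matrix.isHermitian_diagonal_iff.2 fun k => Complex.conj_ofReal _

lemma trace_gmSym_mul {K : ℕ} (p : Pairs K) (B : Matrix (Fin K) (Fin K) ℂ) :
    (gmSym K p * B).trace = (√((K : ℝ) / 2) : ℂ) * (B p.1.2 p.1.1 + B p.1.1 p.1.2) := by
  simp only [gmSym, Matrix.add_mul, Matrix.trace_single_mul, Matrix.smul_mul,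
    Matrix.trace_smul, Matrix.trace_add, smul_eq_mul]
  ring

lemma trace_gmAntisym_mul {K : ℕ} (p : Pairs K) (B : Matrix (Fin K) (Fin K) ℂ) :
    (gmAntisym K p * B).trace =
      (√((K : ℝ) / 2) : ℂ) * (Complex.I * (B p.1.1 p.1.2 - B p.1.2 p.1.1)) := by
  simp only [gmAntisym, Matrix.add_mul, Matrix.trace_single_mul, Matrix.smul_mul,
    Matrix.trace_smul, Matrix.trace_add, smul_eq_mul]
  ring

lemma gmSym_apply_lt {K : ℕ} (p q : Pairs K) :
    gmSym K q p.1.1 p.1.2 = if p = q then (√((K : ℝ) / 2) : ℂ) else 0 := by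
  obtain ⟨⟨a, b⟩, hp : a < b⟩ := p
  obtain ⟨⟨c, e⟩, hq : c < e⟩ := q
  have h : ¬ (a = e ∧ b = c) := fun h => by omega
  simp only [gmSym, Matrix.smul_apply, Matrix.add_apply, Matrix.single_apply, smul_eq_mul,
    Subtype.mk.injEq, Prod.mk.injEq, eq_comm (a := c), eq_comm (a := e)]
  rw [if_neg h]
  split_ifs <;> simp

lemma gmSym_apply_gt {K : ℕ} (p q : Pairs K) :
    gmSym K q p.1.2 p.1.1 = if p = q then (√((K : ℝ) / 2) : ℂ) else 0 := by
  have h : star (gmSym K q p.1.1 p.1.2) = gmSym K q p.1.2 p.1.1 :=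
    (gellMann_isHermitian K (some (Sum.inl q))).apply p.1.2 p.1.1
  rw [← h, gmSym_apply_lt]
  split_ifs <;> simp

lemma gmAntisym_apply_lt {K : ℕ} (p q : Pairs K) :
    gmAntisym K q p.1.1 p.1.2 = if p = q then -(√((K : ℝ) / 2) * Complex.I : ℂ) else 0 := by
  obtain ⟨⟨a, b⟩, hp : a < b⟩ := p
  obtain ⟨⟨c, e⟩, hq : c < e⟩ := q
  have h : ¬ (a = e ∧ b = c) := fun h => by omega
  simp only [gmAntisym, Matrix.smul_apply, Matrix.add_apply, Matrix.single_apply, smul_eq_mul,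
    Subtype.mk.injEq, Prod.mk.injEq, eq_comm (a := c), eq_comm (a := e)]
  rw [if_neg h]
  split_ifs <;> simp

lemma gmAntisym_apply_gt {K : ℕ} (p q : Pairs K) :
    gmAntisym K q p.1.2 p.1.1 = if p = q then (√((K : ℝ) / 2) * Complex.I : ℂ) else 0 := by
  have h : star (gmAntisym K q p.1.1 p.1.2) = gmAntisym K q p.1.2 p.1.1 :=
    (gellMann_isHermitian K (some (Sum.inr (Sum.inl q)))).apply p.1.2 p.1.1
  rw [← h, gmAntisym_apply_lt]
  split_ifs <;> simp

lemma sqrt_half_mul_self (K : ℕ) : (√((K : ℝ) / 2) : ℂ) * √((K : ℝ) / 2) = K / 2 := by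
  rw [← Complex.ofReal_mul, Real.mul_self_sqrt (by positivity)]
  push_cast; rfl

lemma trace_gmDiag_mul_gmDiag {K : ℕ} {i j : Fin (K - 1)} (hij : i ≤ j) :
    (gmDiag K i * gmDiag K j).trace = if i = j then (K : ℂ) else 0 := by
  rw [gmDiag_eq, gmDiag_eq, Matrix.diagonal_mul_diagonal, Matrix.trace_diagonal]
  simp only [← Complex.ofReal_mul]
  rw [← Complex.ofReal_sum]
  set r := √((K : ℝ) / (((i + 1 : ℕ) : ℝ) ^ 2 + ((i + 1 : ℕ) : ℝ))) with hr
  set r' := √((K : ℝ) / (((j + 1 : ℕ) : ℝ) ^ 2 + ((j + 1 : ℕ) : ℝ))) with hr'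
  have e : ∑ k : Fin K, r * diagVec (i + 1) k * (r' * diagVec (j + 1) k) =
      r * r' * ∑ k : Fin K, diagVec (i + 1) k * diagVec (j + 1) k := by
    rw [Finset.mul_sum]
    exact Finset.sum_congr rfl fun k _ => by ring
  have hi := i.2
  rw [e, sum_diagVec (by omega)]
  have hle : (i : ℕ) ≤ j := hij
  -- As `i ≤ j`, the second diagonal is 1 at these positions. If `i < j` it is also 1 at position `i
  -- + 1`, and the first diagonal sums to zero against a constant.
  have e2 : ∑ k ∈ range (i + 1), diagVec (j + 1) k = ((i + 1 : ℕ) : ℝ) := by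
    rw [Finset.sum_congr rfl (g := fun _ => (1 : ℝ))]
    · simp
    · intro k hk
      have := Finset.mem_range.1 hk
      simp [diagVec, (by omega : k < j + 1)]
  rw [e2]
  split_ifs with h
  · subst h
    have hrr : r * r' = (K : ℝ) / (((i + 1 : ℕ) : ℝ) ^ 2 + ((i + 1 : ℕ) : ℝ)) :=
      Real.mul_self_sqrt (by positivity)
    rw [hrr]
    simp only [diagVec, lt_irrefl, if_false, if_true]
    rw [← Complex.ofReal_natCast]
    congr 1
    field_simp
    ring
  · have hlt : (i : ℕ) < j := lt_of_le_of_ne hle fun h' => h (Fin.ext h')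
    simp [diagVec, hlt]

lemma trace_gmDiag {K : ℕ} (i : Fin (K - 1)) : (gmDiag K i).trace = 0 := by
  rw [gmDiag_eq, Matrix.trace_diagonal, ← Complex.ofReal_sum, ← Finset.mul_sum]
  have hi := i.2
  have := sum_diagVec (K := K) (m := i + 1) (by omega) fun _ => 1
  simp only [mul_one] at this
  rw [this]
  simp

lemma gmDiag_apply_ne {K : ℕ} (i : Fin (K - 1)) {a b : Fin K} (h : a ≠ b) :
    gmDiag K i a b = 0 := by
  rw [gmDiag_eq, Matrix.diagonal_apply_ne _ h]

/-- The Gell-Mann basis is orthogonal. -/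
lemma trace_gellMann_mul (K : ℕ) (l m : GMIndex K) :
    (gellMann K l * gellMann K m).trace = if l = m then (K : ℂ) else 0 := by
  have hne : ∀ p : Pairs K, p.1.1 ≠ p.1.2 := fun p => p.2.ne
  have hs := sqrt_half_mul_self K
  have s1 : ∀ p : Pairs K, (gmSym K p).trace = 0 := fun p => by
    rw [← mul_one (gmSym K p), trace_gmSym_mul, Matrix.one_apply_ne (hne p),
      Matrix.one_apply_ne (hne p).symm]
    ring
  have s2 : ∀ p : Pairs K, (gmAntisym K p).trace = 0 := fun p => by
    rw [← mul_one (gmAntisym K p), trace_gmAntisym_mul, Matrix.one_apply_ne (hne p),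
      Matrix.one_apply_ne (hne p).symm]
    ring
  have s3 : ∀ p q : Pairs K, (gmSym K p * gmAntisym K q).trace = 0 := fun p q => by
    rw [trace_gmSym_mul, gmAntisym_apply_lt, gmAntisym_apply_gt]
    split_ifs <;> ring
  have s4 : ∀ (p : Pairs K) i, (gmSym K p * gmDiag K i).trace = 0 := fun p i => by
    rw [trace_gmSym_mul, gmDiag_apply_ne i (hne p), gmDiag_apply_ne i (hne p).symm]
    ring
  have s5 : ∀ (p : Pairs K) i, (gmAntisym K p * gmDiag K i).trace = 0 := fun p i => by
    rw [trace_gmAntisym_mul, gmDiag_apply_ne i (hne p), gmDiag_apply_ne i (hne p).symm]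
    ring
  rcases l with _ | p | p | i <;> rcases m with _ | q | q | j <;> simp only [gellMann]
  · simp
  · simp [s1]
  · simp [s2]
  · simp [trace_gmDiag]
  · simp [s1]
  · rw [trace_gmSym_mul, gmSym_apply_lt, gmSym_apply_gt]
    simp only [Option.some.injEq, Sum.inl.injEq]
    split_ifs
    · linear_combination 2 * hs
    · ring
  · simp [s3]
  · simp [s4]
  · simp [s2]
  · rw [Matrix.trace_mul_comm]; simp [s3]
  · rw [trace_gmAntisym_mul, gmAntisym_apply_lt, gmAntisym_apply_gt]
    simp only [Option.some.injEq, Sum.inl.injEq, Sum.inr.injEq]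
    split_ifs
    · linear_combination (-2 * Complex.I ^ 2) * hs - K * Complex.I_sq
    · ring
  · simp [s5]
  · simp [trace_gmDiag]
  · rw [Matrix.trace_mul_comm]; simp [s4]
  · rw [Matrix.trace_mul_comm]; simp [s5]
  · simp only [Option.some.injEq, Sum.inr.injEq]
    rcases le_total i j with h | h
    · exact trace_gmDiag_mul_gmDiag h
    · rw [Matrix.trace_mul_comm, trace_gmDiag_mul_gmDiag h]
      simp only [eq_comm]

/-- A crude bound suffices: powers of `K` are absorbed in `K^{C d²}`. -/
lemma norm_gellMann_apply_le {K : ℕ} (hK : 2 ≤ K) (l : GMIndex K) (a b : Fin K) :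
    ‖gellMann K l a b‖ ≤ (K : ℝ) ^ 2 := by
  have hK' : (2 : ℝ) ≤ K := by exact_mod_cast hK
  have hsq : √((K : ℝ) / 2) ≤ K := by
    rw [Real.sqrt_le_left (by positivity)]
    nlinarith
  have hs0 : 0 ≤ √((K : ℝ) / 2) := Real.sqrt_nonneg _
  have hsingle : ∀ (c e : Fin K) (z : ℂ), ‖z‖ = 1 → ‖Matrix.single c e z a b‖ ≤ 1 := by
    intro c e z hz
    rw [Matrix.single_apply]
    split_ifs <;> simp [hz]
  rcases l with _ | p | p | i <;> simp only [gellMann]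
  · rw [Matrix.one_apply]
    split_ifs
    · rw [norm_one]; nlinarith
    · rw [norm_zero]; positivity
  · rw [gmSym, Matrix.smul_apply, Matrix.add_apply, norm_smul, Complex.norm_real,
      Real.norm_of_nonneg hs0]
    have := (norm_add_le _ _).trans (add_le_add (hsingle p.1.1 p.1.2 1 norm_one)
      (hsingle p.1.2 p.1.1 1 norm_one))
    nlinarith [norm_nonneg (Matrix.single p.1.1 p.1.2 (1 : ℂ) a b +
      Matrix.single p.1.2 p.1.1 (1 : ℂ) a b)]
  · rw [gmAntisym, Matrix.smul_apply, Matrix.add_apply, norm_smul, Complex.norm_real,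
      Real.norm_of_nonneg hs0]
    have := (norm_add_le _ _).trans (add_le_add
      (hsingle p.1.1 p.1.2 (-Complex.I) (by simp)) (hsingle p.1.2 p.1.1 Complex.I (by simp)))
    nlinarith [norm_nonneg (Matrix.single p.1.1 p.1.2 (-Complex.I) a b +
      Matrix.single p.1.2 p.1.1 Complex.I a b)]
  · rw [gmDiag_eq, Matrix.diagonal_apply]
    split_ifs
    · rw [Complex.norm_real, Real.norm_eq_abs, abs_mul, abs_of_nonneg (Real.sqrt_nonneg _),
        show (K : ℝ) ^ 2 = K * K from pow_two _]
      have hi : ((i + 1 : ℕ) : ℝ) ≤ K := by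
        have := i.2
        exact_mod_cast (by omega : (i + 1 : ℕ) ≤ K)
      have hi1 : (1 : ℝ) ≤ ((i + 1 : ℕ) : ℝ) := by exact_mod_cast (by omega : 1 ≤ (i + 1 : ℕ))
      refine mul_le_mul ?_ ?_ (abs_nonneg _) (by positivity)
      · rw [Real.sqrt_le_left (by positivity)]
        refine (div_le_self (by positivity) (by nlinarith)).trans (by nlinarith)
      · rw [diagVec]
        split_ifs
        · rw [abs_one]; linarith
        · rw [abs_neg, Nat.abs_cast]; exact hi
        · rw [abs_zero]; positivity
    · rw [norm_zero]; positivity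

end Qudit

end

/-! ### Tensor products, states, and Parseval's identity for qudits -/

noncomputable section

namespace Qudit

open Finset BigOperators Matrix
open scoped ComplexOrder

variable {K n : ℕ}

lemma tensor_mul_tensor (M N : Fin n → Matrix (Fin K) (Fin K) ℂ) :
    tensor M * tensor N = tensor fun j => M j * N j := by
  ext x y
  simp only [tensor, Matrix.mul_apply, Matrix.of_apply, ← Finset.prod_mul_distrib]
  exact (Fintype.prod_sum fun j z => M j (x j) z * N j z (y j)).symm

lemma trace_tensor (M : Fin n → Matrix (Fin K) (Fin K) ℂ) :
    (tensor M).trace = ∏ j, (M j).trace := by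
  simp only [tensor, Matrix.trace, Matrix.diag_apply, Matrix.of_apply]
  exact (Fintype.prod_sum fun j z => M j z z).symm

lemma conjTranspose_tensor (M : Fin n → Matrix (Fin K) (Fin K) ℂ) :
    (tensor M)ᴴ = tensor fun j => (M j)ᴴ := by
  ext x y
  simp only [tensor, Matrix.conjTranspose_apply, Matrix.of_apply, star_prod]

open scoped MatrixOrder in
lemma exists_factor_of_posSemidef {m : Type*} [Fintype m] [DecidableEq m] {A : Matrix m m ℂ}
    (hA : A.PosSemidef) : ∃ B : Matrix m m ℂ, A = Bᴴ * B :=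
  CStarAlgebra.nonneg_iff_eq_star_mul_self.mp hA.nonneg

lemma norm_mulVec_le (A : Op K n) (v : (Fin n → Fin K) → ℂ) :
    ‖WithLp.toLp 2 (A *ᵥ v)‖ ≤ opNorm A * ‖WithLp.toLp 2 v‖ :=
  (Matrix.toEuclideanCLM (𝕜 := ℂ) A).le_opNorm (WithLp.toLp 2 v)

lemma opNorm_nonneg (A : Op K n) : 0 ≤ opNorm A := norm_nonneg _

lemma trace_conjTranspose_mul_self (B : Op K n) :
    (Bᴴ * B).trace = ((∑ y, ‖WithLp.toLp 2 fun x => B x y‖ ^ 2 : ℝ) : ℂ) := by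
  simp only [Matrix.trace, Matrix.diag_apply, Matrix.mul_apply, Matrix.conjTranspose_apply,
    EuclideanSpace.norm_sq_eq]
  push_cast
  refine Finset.sum_congr rfl fun y _ => Finset.sum_congr rfl fun x _ => ?_
  rw [RCLike.star_def, Complex.conj_mul']

/-- The expectation of an operator in a state is bounded by the operator norm. -/
lemma norm_trace_mul_factor_le (A B : Op K n) :
    ‖(A * (B * Bᴴ)).trace‖ ≤ opNorm A * ((Bᴴ * B).trace).re := by
  -- The trace is a sum of quadratic forms of `A` at the columns of `B`.
  have h1 : (A * (B * Bᴴ)).trace =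
      ∑ y, inner ℂ (WithLp.toLp 2 fun x => B x y) (WithLp.toLp 2 (A *ᵥ fun x => B x y)) := by
    rw [← Matrix.mul_assoc, Matrix.trace_mul_comm]
    simp only [Matrix.trace, Matrix.diag_apply, Matrix.mul_apply, Matrix.conjTranspose_apply,
      PiLp.inner_apply, RCLike.inner_apply, Matrix.mulVec, dotProduct]
    refine Finset.sum_congr rfl fun y _ => Finset.sum_congr rfl fun x _ => ?_
    rw [mul_comm]; rfl
  rw [h1, trace_conjTranspose_mul_self, Complex.ofReal_re, Finset.mul_sum]
  refine (norm_sum_le _ _).trans (Finset.sum_le_sum fun y _ => ?_)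
  refine (norm_inner_le_norm _ _).trans ?_
  calc _ ≤ ‖WithLp.toLp 2 fun x => B x y‖ * (opNorm A * ‖WithLp.toLp 2 fun x => B x y‖) :=
        mul_le_mul_of_nonneg_left (norm_mulVec_le A _) (norm_nonneg _)
    _ = _ := by ring

lemma norm_trace_mul_le_of_isProductState {A ρ : Op K n} (hρ : IsProductState ρ) :
    ‖(A * ρ).trace‖ ≤ opNorm A := by
  obtain ⟨σ, hσ, rfl⟩ := hρ
  choose B hB using fun j => exists_factor_of_posSemidef (hσ j).1
  have h : tensor σ = (tensor fun j => (B j)ᴴ) * (tensor fun j => (B j)ᴴ)ᴴ := by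
    rw [conjTranspose_tensor, tensor_mul_tensor]
    congr 1
    funext j
    rw [Matrix.conjTranspose_conjTranspose]
    exact hB j
  have ht : (((tensor fun j => (B j)ᴴ)ᴴ * tensor fun j => (B j)ᴴ) : Op K n).trace = 1 := by
    rw [Matrix.trace_mul_comm, ← h, trace_tensor]
    exact Finset.prod_eq_one fun j _ => (hσ j).2
  rw [h]
  refine (norm_trace_mul_factor_le _ _).trans ?_
  rw [ht, Complex.one_re, mul_one]

/-- Each column is the image of a unit vector. This settles the range `t² ≤ ε`, where the output 0
is good enough. -/
lemma normSq₂_le_opNorm_sq (hK : 0 < K) (A : Op K n) : normSq₂ A ≤ opNorm A ^ 2 := by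
  have hcol : ∀ y, ‖WithLp.toLp 2 fun x => A x y‖ ≤ opNorm A := fun y => by
    have := norm_mulVec_le A (Pi.single y 1)
    rw [Matrix.mulVec_single_one] at this
    refine this.trans (le_of_eq ?_)
    rw [PiLp.toLp_single, PiLp.norm_single, norm_one, mul_one]
  rw [normSq₂, inner₂, trace_conjTranspose_mul_self]
  have e : ((K : ℂ) ^ n)⁻¹ = ((((K : ℝ) ^ n)⁻¹ : ℝ) : ℂ) := by push_cast; rfl
  rw [e, ← Complex.ofReal_mul, Complex.ofReal_re, inv_mul_le_iff₀ (by positivity)]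
  calc ∑ y, ‖WithLp.toLp 2 fun x => A x y‖ ^ 2 ≤ ∑ y : Fin n → Fin K, opNorm A ^ 2 :=
        Finset.sum_le_sum fun y _ => pow_le_pow_left₀ (norm_nonneg _) (hcol y) 2
    _ = _ := by simp

/-- The Gell-Mann basis of `n` qudits. -/
def gmTensor (α : Fin n → GMIndex K) : Op K n := tensor fun j => gellMann K (α j)

lemma gmTensor_isHermitian (α : Fin n → GMIndex K) : (gmTensor α).IsHermitian := by
  rw [Matrix.IsHermitian, gmTensor, conjTranspose_tensor]
  congr 1
  funext j
  exact gellMann_isHermitian K _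

lemma trace_gmTensor_mul (α β : Fin n → GMIndex K) :
    (gmTensor α * gmTensor β).trace = if α = β then (K : ℂ) ^ n else 0 := by
  rw [gmTensor, gmTensor, tensor_mul_tensor, trace_tensor]
  simp only [trace_gellMann_mul]
  split_ifs with h
  · subst h; simp
  · obtain ⟨j, hj⟩ := Function.ne_iff.1 h
    exact Finset.prod_eq_zero (Finset.mem_univ j) (if_neg hj)

lemma trace_gmTensor_mul_sum (a : (Fin n → GMIndex K) → ℂ) (α : Fin n → GMIndex K) :
    (gmTensor α * ∑ β, a β • gmTensor β).trace = (K : ℂ) ^ n * a α := by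
  simp only [Matrix.mul_sum, Matrix.mul_smul, Matrix.trace_sum, Matrix.trace_smul,
    trace_gmTensor_mul, smul_eq_mul, mul_ite, mul_zero]
  rw [Finset.sum_ite_eq, if_pos (Finset.mem_univ _), mul_comm]

/-- Parseval's identity in the Gell-Mann basis. -/
lemma normSq₂_sum (hK : 0 < K) (a : (Fin n → GMIndex K) → ℝ) :
    normSq₂ (∑ α, (a α : ℂ) • gmTensor α) = ∑ α, a α ^ 2 := by
  have hK' : (K : ℂ) ^ n ≠ 0 := pow_ne_zero _ (by exact_mod_cast hK.ne')
  have h : (∑ α, (a α : ℂ) • gmTensor α)ᴴ = ∑ α, (a α : ℂ) • gmTensor α := by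
    rw [Matrix.conjTranspose_sum]
    refine Finset.sum_congr rfl fun α _ => ?_
    rw [Matrix.conjTranspose_smul, gmTensor_isHermitian α, RCLike.star_def, Complex.conj_ofReal]
  rw [normSq₂, inner₂, h]
  nth_rw 1 [Matrix.sum_mul]
  simp only [Matrix.smul_mul, Matrix.trace_sum, Matrix.trace_smul, trace_gmTensor_mul_sum,
    smul_eq_mul]
  rw [Finset.mul_sum, Complex.re_sum]
  refine Finset.sum_congr rfl fun α _ => ?_
  rw [show ((K : ℂ) ^ n)⁻¹ * ((a α : ℂ) * ((K : ℂ) ^ n * (a α : ℂ))) = ((a α ^ 2 : ℝ) : ℂ) by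
    push_cast; field_simp, Complex.ofReal_re]

/-- The coefficient is a multiple of the trace of a product of two Hermitian matrices, which is
real. -/
lemma coeff_real_of_isHermitian (hK : 0 < K) {a : (Fin n → GMIndex K) → ℂ}
    (h : (∑ α, a α • gmTensor α).IsHermitian) (α : Fin n → GMIndex K) :
    ((a α).re : ℂ) = a α := by
  have hK' : (K : ℂ) ^ n ≠ 0 := pow_ne_zero _ (by exact_mod_cast hK.ne')
  have h1 := trace_gmTensor_mul_sum a α
  have h2 : star ((K : ℂ) ^ n * a α) = (K : ℂ) ^ n * a α := by
    rw [← h1, ← Matrix.trace_conjTranspose, Matrix.conjTranspose_mul, h, gmTensor_isHermitian α,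
      Matrix.trace_mul_comm]
  rw [star_mul, star_pow, star_natCast, mul_comm] at h2
  exact Complex.conj_eq_iff_re.1 (mul_left_cancel₀ hK' h2)

/-- The indices of the traceless Gell-Mann matrices. -/
abbrev Traceless (K : ℕ) : Type := Pairs K ⊕ Pairs K ⊕ Fin (K - 1)

lemma card_traceless_le (hK : 2 ≤ K) : Fintype.card (Traceless K) ≤ K ^ 4 := by
  have h1 : Fintype.card (Pairs K) ≤ K ^ 2 := by
    refine (Fintype.card_subtype_le _).trans ?_
    simp [pow_two]
  rw [Fintype.card_sum, Fintype.card_sum, Fintype.card_fin]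
  have : K ^ 4 = K ^ 2 * K ^ 2 := by ring
  nlinarith [Nat.sub_le K 1, (by nlinarith : 4 ≤ K ^ 2), (by nlinarith : K ≤ K ^ 2)]

/-- The one-qudit matrix with Bloch vector `K^{-8} y`. -/
def blochState (K : ℕ) (y : Traceless K → ℝ) : Matrix (Fin K) (Fin K) ℂ :=
  (K : ℂ)⁻¹ • 1 + ∑ l, ((((K : ℝ) ^ 8)⁻¹ * y l : ℝ) : ℂ) • gellMann K (some l)

lemma blochState_isHermitian (y : Traceless K → ℝ) : (blochState K y).IsHermitian := by
  rw [blochState, Matrix.IsHermitian, Matrix.conjTranspose_add, Matrix.conjTranspose_sum,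
    Matrix.conjTranspose_smul, Matrix.conjTranspose_one, star_inv₀, star_natCast]
  congr 1
  refine Finset.sum_congr rfl fun l _ => ?_
  rw [Matrix.conjTranspose_smul, gellMann_isHermitian K _, RCLike.star_def, Complex.conj_ofReal]

/-- The factor `K^{-7}` is `K^{-8}` times the trace `K` of a squared basis matrix. -/
lemma trace_gellMann_mul_blochState (hK : 0 < K) (y : Traceless K → ℝ) (l : GMIndex K) :
    (gellMann K l * blochState K y).trace =
      ((l.elim 1 fun m => ((K : ℝ) ^ 7)⁻¹ * y m : ℝ) : ℂ) := by
  have hK' : (K : ℂ) ≠ 0 := by exact_mod_cast hK.ne'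
  have h1 : (gellMann K l).trace = if l = none then (K : ℂ) else 0 := by
    rw [← trace_gellMann_mul K l none, gellMann, mul_one]
  simp only [blochState, Matrix.mul_add, Matrix.mul_smul, mul_one, Matrix.mul_sum,
    Matrix.trace_add, Matrix.trace_smul, Matrix.trace_sum, h1, trace_gellMann_mul, smul_eq_mul]
  cases l with
  | none => simp [hK']
  | some m =>
    simp only [reduceCtorEq, if_false, mul_zero, zero_add, Option.some.injEq, mul_ite,
      Finset.sum_ite_eq, Finset.mem_univ, if_true, Option.elim]
    push_cast
    field_simp

/-- The exponent 8 is chosen for positivity: at most `K^4` terms with entries at most `K^2` leave a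
perturbation with entries at most `K^{-2}`. By Cauchy–Schwarz its quadratic form is then at most
`K^{-1} ‖v‖²`, which the multiple of the identity compensates. -/
lemma blochState_isDensity (hK : 2 ≤ K) {y : Traceless K → ℝ} (hy : ∀ l, |y l| ≤ 1) :
    IsDensity (blochState K y) := by
  have hK0 : 0 < K := by omega
  have hKr : (0 : ℝ) < K := by exact_mod_cast hK0
  refine ⟨?_, ?_⟩
  swap
  · have := trace_gellMann_mul_blochState hK0 y none
    simpa [gellMann] using this
  set H : Matrix (Fin K) (Fin K) ℂ :=
    ∑ l, ((((K : ℝ) ^ 8)⁻¹ * y l : ℝ) : ℂ) • gellMann K (some l) with hH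
  have hHe : ∀ a b, ‖H a b‖ ≤ ((K : ℝ) ^ 2)⁻¹ := fun a b => by
    rw [hH, Matrix.sum_apply]
    calc _ ≤ ∑ l : Traceless K, ((K : ℝ) ^ 6)⁻¹ := by
          refine (norm_sum_le _ _).trans (Finset.sum_le_sum fun l _ => ?_)
          rw [Matrix.smul_apply, norm_smul, Complex.norm_real, Real.norm_eq_abs, abs_mul,
            abs_of_nonneg (by positivity : (0 : ℝ) ≤ ((K : ℝ) ^ 8)⁻¹)]
          calc ((K : ℝ) ^ 8)⁻¹ * |y l| * ‖gellMann K (some l) a b‖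
              ≤ ((K : ℝ) ^ 8)⁻¹ * 1 * (K : ℝ) ^ 2 := by
                gcongr
                · exact hy l
                · exact norm_gellMann_apply_le hK _ _ _
            _ = _ := by field_simp
      _ = Fintype.card (Traceless K) * ((K : ℝ) ^ 6)⁻¹ := by simp
      _ ≤ (K : ℝ) ^ 4 * ((K : ℝ) ^ 6)⁻¹ := by
          gcongr
          exact_mod_cast card_traceless_le hK
      _ = _ := by field_simp
  refine Matrix.PosSemidef.of_dotProduct_mulVec_nonneg (blochState_isHermitian y) fun v => ?_
  have hreal : (star v ⬝ᵥ blochState K y *ᵥ v).im = 0 := by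
    have := (blochState_isHermitian y).im_star_dotProduct_mulVec_self v
    simpa using this
  rw [Complex.nonneg_iff]
  refine ⟨?_, hreal.symm⟩
  have e : star v ⬝ᵥ blochState K y *ᵥ v =
      (((K : ℝ)⁻¹ * ∑ a, ‖v a‖ ^ 2 : ℝ) : ℂ) + star v ⬝ᵥ H *ᵥ v := by
    rw [blochState, Matrix.add_mulVec, dotProduct_add, Matrix.smul_mulVec, Matrix.one_mulVec,
      dotProduct_smul]
    congr 1
    simp only [dotProduct, Pi.star_apply, RCLike.star_def, Complex.conj_mul', smul_eq_mul]
    push_cast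
    rfl
  have hb : ‖star v ⬝ᵥ H *ᵥ v‖ ≤ (K : ℝ)⁻¹ * ∑ a, ‖v a‖ ^ 2 := by
    calc ‖star v ⬝ᵥ H *ᵥ v‖ ≤ ∑ a, ∑ b, ‖v a‖ * (((K : ℝ) ^ 2)⁻¹ * ‖v b‖) := by
          simp only [dotProduct, Matrix.mulVec, Finset.mul_sum]
          refine (norm_sum_le _ _).trans (Finset.sum_le_sum fun a _ =>
            (norm_sum_le _ _).trans (Finset.sum_le_sum fun b _ => ?_))
          rw [norm_mul, norm_mul, Pi.star_apply, norm_star]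
          gcongr
          exact hHe a b
      _ = ((K : ℝ) ^ 2)⁻¹ * (∑ a, ‖v a‖) ^ 2 := by
          rw [pow_two (∑ a, ‖v a‖), Finset.sum_mul_sum, Finset.mul_sum]
          refine Finset.sum_congr rfl fun a _ => ?_
          rw [Finset.mul_sum]
          exact Finset.sum_congr rfl fun b _ => by ring
      _ ≤ ((K : ℝ) ^ 2)⁻¹ * (K * ∑ a, ‖v a‖ ^ 2) := by
          gcongr
          simpa using sq_sum_le_card_mul_sum_sq (s := univ) (f := fun a => ‖v a‖)
      _ = _ := by field_simp
  rw [e, Complex.add_re, Complex.ofReal_re]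
  have := (abs_le.1 ((Complex.abs_re_le_norm _).trans hb)).1
  linarith

end Qudit

end

/-! ### Reduction to the cube, the learner, and the parameters -/

noncomputable section

namespace Qudit

open Finset BigOperators Matrix Cube

variable {K n : ℕ}

/-- The product state with Bloch vectors `K^{-8} y`. -/
def prodState (y : Fin n × Traceless K → ℝ) : Op K n :=
  tensor fun j => blochState K fun l => y (j, l)

lemma prodState_isProductState (hK : 2 ≤ K) {y : Fin n × Traceless K → ℝ} (hy : ∀ p, |y p| ≤ 1) :
    IsProductState (prodState y) :=
  ⟨_, fun _ => blochState_isDensity hK fun _ => hy _, rfl⟩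

/-- The set of the pairs (site, Gell-Mann matrix) that occur in a basis element. -/
def supp (α : Fin n → GMIndex K) : Finset (Fin n × Traceless K) :=
  univ.filter fun p => α p.1 = some p.2

lemma prod_supp {M : Type*} [CommMonoid M] (α : Fin n → GMIndex K) (f : Fin n × Traceless K → M) :
    ∏ p ∈ supp α, f p = ∏ j, (α j).elim 1 fun l => f (j, l) := by
  rw [supp, Finset.prod_filter, Fintype.prod_prod_type]
  refine Finset.prod_congr rfl fun j _ => ?_
  change (∏ l, if α j = some l then f (j, l) else 1) = _
  cases α j with
  | none => simp only [reduceCtorEq, if_false, Finset.prod_const_one, Option.elim]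
  | some m =>
    simp only [Option.some.injEq, Finset.prod_ite_eq, Finset.mem_univ, if_true, Option.elim]

lemma card_supp (α : Fin n → GMIndex K) : #(supp α) = weight α := by
  -- Counting is a product in `Multiplicative ℕ`, so the product formula applies.
  have h := prod_supp α fun _ => Multiplicative.ofAdd 1
  rw [Finset.prod_const, ← ofAdd_nsmul, smul_eq_mul, mul_one] at h
  have h2 : ∏ j, ((α j).elim 1 fun _ => Multiplicative.ofAdd 1) =
      Multiplicative.ofAdd (weight α) := by
    rw [weight, Finset.card_filter, ofAdd_sum]
    refine Finset.prod_congr rfl fun j _ => ?_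
    cases α j <;> simp
  exact Multiplicative.ofAdd.injective (h.trans h2)

lemma supp_injective : Function.Injective (supp : (Fin n → GMIndex K) → _) := by
  intro α β h
  have h' : ∀ j l, α j = some l ↔ β j = some l := fun j l => by
    have := congrArg (fun s => (j, l) ∈ s) h
    simpa [supp] using this
  funext j
  exact Option.ext fun l => h' j l

/-- The scale of the Fourier coefficients of the expectation of a basis element of weight `w`. -/
def scale (K w : ℕ) : ℝ := (((K : ℝ) ^ 7)⁻¹) ^ w

lemma scale_pos (hK : 0 < K) (w : ℕ) : 0 < scale K w := by
  have : (0 : ℝ) < K := by exact_mod_cast hK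
  unfold scale; positivity

lemma trace_gmTensor_mul_prodState (hK : 0 < K) (α : Fin n → GMIndex K)
    (y : Fin n × Traceless K → ℝ) :
    (gmTensor α * prodState y).trace = ((scale K (weight α) * mono (supp α) y : ℝ) : ℂ) := by
  rw [gmTensor, prodState, tensor_mul_tensor, trace_tensor]
  simp only [trace_gellMann_mul_blochState hK]
  rw [← Complex.ofReal_prod, ← prod_supp α fun p => ((K : ℝ) ^ 7)⁻¹ * y p,
    Finset.prod_mul_distrib, Finset.prod_const, card_supp]
  rfl

/-- The basis elements of weight one read off each coordinate of `y`. Injectivity lets the learner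
recover the vertex from the state, and makes a uniform draw from `S` a uniform draw of a vertex. -/
lemma prodState_injective (hK : 0 < K) :
    Function.Injective (prodState : (Fin n × Traceless K → ℝ) → Op K n) := by
  intro y z h
  funext ⟨j, l⟩
  set α : Fin n → GMIndex K := Function.update (fun _ => none) j (some l) with hα
  have hs : supp α = {(j, l)} := by
    ext ⟨i, m⟩
    simp only [supp, hα, Finset.mem_filter, Finset.mem_univ, true_and, Finset.mem_singleton,
      Prod.mk.injEq]
    by_cases hi : i = j
    · subst hi; simp [eq_comm]
    · simp [hi]
  have h1 : (gmTensor α * prodState y).trace = (gmTensor α * prodState z).trace := by rw [h]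
  rw [trace_gmTensor_mul_prodState hK, trace_gmTensor_mul_prodState hK, hs] at h1
  have h2 := mul_left_cancel₀ (scale_pos hK _).ne' (Complex.ofReal_injective h1)
  simpa [mono] using h2

lemma sgn_injective : Function.Injective sgn := by
  rintro (_ | _) (_ | _) h
  · rfl
  · norm_num [sgn] at h
  · norm_num [sgn] at h
  · rfl

lemma vertex_injective {ι : Type*} : Function.Injective (vertex : (ι → Bool) → ι → ℝ) :=
  fun _ _ h => funext fun i => sgn_injective (congrFun h i)

/-- The product states at which observables are sampled. -/
def vertexState (x : Fin n × Traceless K → Bool) : Op K n := prodState (vertex x)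

lemma vertexState_injective (hK : 0 < K) :
    Function.Injective (vertexState : (Fin n × Traceless K → Bool) → Op K n) :=
  (prodState_injective hK).comp vertex_injective

/-- The Fourier coefficients of `y ↦ tr[A ρ(y)]` for `A = ∑ a_α M_α`. -/
def cubeCoeff (a : (Fin n → GMIndex K) → ℝ) : Finset (Fin n × Traceless K) → ℝ :=
  Function.extend supp (fun α => scale K (weight α) * a α) 0

lemma cubeCoeff_supp (a : (Fin n → GMIndex K) → ℝ) (α : Fin n → GMIndex K) :
    cubeCoeff a (supp α) = scale K (weight α) * a α :=
  supp_injective.extend_apply _ _ _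

/-- Sets that are not supports, that is, with two pairs at the same site, carry the default
coefficient 0. -/
lemma cubeCoeff_eq_zero {d : ℕ} {a : (Fin n → GMIndex K) → ℝ}
    (ha : ∀ α, d < weight α → a α = 0) (S : Finset (Fin n × Traceless K)) (hS : d < #S) :
    cubeCoeff a S = 0 := by
  by_cases h : ∃ α, supp α = S
  · obtain ⟨α, rfl⟩ := h
    rw [cubeCoeff_supp, ha α (by rwa [← card_supp]), mul_zero]
  · exact Function.extend_apply' _ _ _ h

lemma trace_mul_prodState (hK : 0 < K) (a : (Fin n → GMIndex K) → ℝ)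
    (y : Fin n × Traceless K → ℝ) :
    ((∑ α, (a α : ℂ) • gmTensor α) * prodState y).trace = ((poly (cubeCoeff a) y : ℝ) : ℂ) := by
  simp only [Matrix.sum_mul, Matrix.smul_mul, Matrix.trace_sum, Matrix.trace_smul,
    trace_gmTensor_mul_prodState hK, smul_eq_mul, ← Complex.ofReal_mul, ← Complex.ofReal_sum]
  congr 1
  rw [poly]
  refine Finset.sum_of_injOn supp supp_injective.injOn (by simp) ?_ ?_
  · intro S _ hS
    rw [cubeCoeff, Function.extend_apply' _ _ _ fun ⟨α, hα⟩ => hS ⟨α, by simp, hα⟩]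
    simp
  · intro α _
    rw [cubeCoeff_supp]; ring

/-- Thresholded empirical Gell-Mann coefficients. -/
def learner (K n d : ℕ) (b : ℝ) {s : ℕ} (data : Fin s → Op K n × ℂ) : Op K n :=
  ∑ α, (((if weight α ≤ d then (scale K (weight α))⁻¹ * threshold b
    (emp (supp α) (fun k => Function.invFun vertexState (data k).1) fun k => (data k).2.re)
      else 0 : ℝ)) : ℂ) • gmTensor α

lemma learner_isHermitian (d : ℕ) (b : ℝ) {s : ℕ} (data : Fin s → Op K n × ℂ) :
    (learner K n d b data).IsHermitian := by
  rw [learner, Matrix.IsHermitian, Matrix.conjTranspose_sum]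
  refine Finset.sum_congr rfl fun α _ => ?_
  rw [Matrix.conjTranspose_smul, gmTensor_isHermitian α, RCLike.star_def, Complex.conj_ofReal]

/-- Parseval's identity on both sides; undoing the scale `K^{-7w}` with `w ≤ d` costs `K^{14d}` in
the squares. -/
lemma normSq₂_sub_learner_le (hK : 0 < K) {d : ℕ} (b : ℝ) {s : ℕ}
    {a : (Fin n → GMIndex K) → ℝ} (ha : ∀ α, d < weight α → a α = 0)
    (x : Fin s → Fin n × Traceless K → Bool) :
    normSq₂ ((∑ α, (a α : ℂ) • gmTensor α) -
        learner K n d b (samples (∑ α, (a α : ℂ) • gmTensor α) fun k => vertexState (x k))) ≤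
      (K : ℝ) ^ (14 * d) * ∑ S with #S ≤ d, (cubeCoeff a S -
        threshold b (emp S x fun k => poly (cubeCoeff a) (vertex (x k)))) ^ 2 := by
  have hK1 : (1 : ℝ) ≤ K := by exact_mod_cast hK
  have h1 : ∀ k, Function.invFun (vertexState : _ → Op K n) (vertexState (x k)) = x k := fun k =>
    Function.leftInverse_invFun (vertexState_injective hK) (x k)
  have h2 : ∀ k, (((∑ α, (a α : ℂ) • gmTensor α) * vertexState (x k)).trace).re =
      poly (cubeCoeff a) (vertex (x k)) := fun k => by
    rw [vertexState, trace_mul_prodState hK, Complex.ofReal_re]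
  simp only [learner, samples, h1, h2]
  set e : Finset (Fin n × Traceless K) → ℝ := fun S =>
    threshold b (emp S x fun k => poly (cubeCoeff a) (vertex (x k))) with he
  rw [← Finset.sum_sub_distrib]
  simp only [← sub_smul, ← Complex.ofReal_sub]
  rw [normSq₂_sum hK, Finset.mul_sum]
  calc ∑ α, (a α - if weight α ≤ d then (scale K (weight α))⁻¹ * e (supp α) else 0) ^ 2
      = ∑ α with weight α ≤ d, (a α - (scale K (weight α))⁻¹ * e (supp α)) ^ 2 := by
        rw [Finset.sum_filter]
        refine Finset.sum_congr rfl fun α _ => ?_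
        split_ifs with h
        · rfl
        · rw [ha α (by omega)]; simp
    _ ≤ ∑ α with weight α ≤ d, (K : ℝ) ^ (14 * d) * (cubeCoeff a (supp α) - e (supp α)) ^ 2 := by
        refine Finset.sum_le_sum fun α hα => ?_
        have hw : weight α ≤ d := (Finset.mem_filter.1 hα).2
        have hs := scale_pos hK (weight α)
        rw [cubeCoeff_supp]
        have e1 : a α - (scale K (weight α))⁻¹ * e (supp α) =
            (scale K (weight α))⁻¹ * (scale K (weight α) * a α - e (supp α)) := by
          field_simp
        rw [e1, mul_pow]
        gcongr
        rw [scale, inv_pow, inv_pow, inv_pow, inv_inv, ← pow_mul, ← pow_mul]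
        exact pow_le_pow_right₀ hK1 (by omega)
    _ = ∑ S ∈ (univ.filter fun α : Fin n → GMIndex K => weight α ≤ d).image supp,
          (K : ℝ) ^ (14 * d) * (cubeCoeff a S - e S) ^ 2 := by
        rw [Finset.sum_image supp_injective.injOn]
    _ ≤ _ := by
        refine Finset.sum_le_sum_of_subset_of_nonneg (fun S hS => ?_) fun _ _ _ => by positivity
        obtain ⟨α, hα, rfl⟩ := Finset.mem_image.1 hS
        rw [Finset.mem_filter, card_supp]
        exact ⟨Finset.mem_univ _, (Finset.mem_filter.1 hα).2⟩

lemma iidUniformProb_image {X Y : Type*} [Fintype X] [DecidableEq Y] {f : X → Y}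
    (hf : Function.Injective f) (s : ℕ) (E : (Fin s → Y) → Prop) :
    iidUniformProb (univ.image f) s E =
      (Nat.card {x : Fin s → X // E fun k => f (x k)} : ℝ) / (Fintype.card X : ℝ) ^ s := by
  rw [iidUniformProb, Finset.card_image_of_injective _ hf, Finset.card_univ]
  congr 2
  let e : X ≃ (univ.image f : Finset Y) := Equiv.ofBijective
    (fun x => ⟨f x, Finset.mem_image_of_mem f (Finset.mem_univ x)⟩)
    ⟨fun x y h => hf (congrArg Subtype.val h), fun ⟨y, hy⟩ => by
      obtain ⟨x, _, rfl⟩ := Finset.mem_image.1 hy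
      exact ⟨x, rfl⟩⟩
  exact (Nat.card_congr ((Equiv.arrowCongr (Equiv.refl (Fin s)) e).subtypeEquiv
    fun x => Iff.rfl)).symm

lemma iidUniformProb_nonneg {X : Type*} (S : Finset X) (s : ℕ) (E : (Fin s → X) → Prop) :
    0 ≤ iidUniformProb S s E := by
  unfold iidUniformProb; positivity

lemma iidUniformProb_of_forall {X Y : Type*} [Fintype X] [Nonempty X] [DecidableEq Y] {f : X → Y}
    (hf : Function.Injective f) (s : ℕ) {E : (Fin s → Y) → Prop} (hE : ∀ y, E y) :
    iidUniformProb (univ.image f) s E = 1 := by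
  rw [iidUniformProb_image hf]
  have : Nat.card {x : Fin s → X // E fun k => f (x k)} = Fintype.card X ^ s := by
    rw [Nat.card_congr (Equiv.subtypeUnivEquiv fun x => hE _)]
    simp
  rw [this, Nat.cast_pow]
  exact div_self (pow_ne_zero _ (by exact_mod_cast Fintype.card_ne_zero))

lemma card_filter_le_natCard {ι : Type*} [Fintype ι] [DecidableEq ι] {s : ℕ}
    {p q : (Fin s → ι → Bool) → Prop} [DecidablePred p] (h : ∀ x, p x → q x) : #{x | p x} ≤ Nat.card {x // q x} := by
  rw [← Fintype.card_subtype, ← Nat.card_eq_fintype_card]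
  exact Nat.card_le_card_of_injective (Subtype.map id h)
    (Subtype.map_injective _ Function.injective_id)

/-- Choice of the light-variable level `τ` and of the accuracy `b`. -/
lemma exists_parameters {k T ε : ℝ} {d : ℕ} (hd : 1 ≤ d) (hk : 2 ≤ k) (hT : 1 ≤ T) (hε : 0 < ε)
    (hεT : ε ≤ T ^ 2) : ∃ B τ b : ℝ, 2 * 30 ^ d * T ≤ B ∧ 0 < τ ∧ 0 < b ∧ b ≤ T ∧
      k ^ (14 * d) * (9 * (τ * B + b ^ 2 * (1 + (B / τ) ^ d))) ≤ ε ∧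
      16 * T ^ 2 / b ^ 2 ≤ (k * T) ^ (54 * d ^ 2) * (ε ^ (d + 1))⁻¹ := by
  have hk0 : 0 < k := by linarith
  have hk1 : 1 ≤ k := by linarith
  have hT0 : 0 < T := by linarith
  -- Here `2·30^d ≤ 60^d ≤ (2^6)^d ≤ k^(6d)`.
  set B := k ^ (6 * d) * T with hB
  -- In the exponent, `14d` pays for the rescaling and `5d` for the constant `27 ≤ 2^5`: three terms
  -- of size at most `τB`, each with factor 9.
  set τ := ε / (k ^ (19 * d) * B) with hτ
  have hB0 : 0 < B := by positivity
  have hτ0 : 0 < τ := by positivity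
  have hTB : T ≤ B := le_mul_of_one_le_left hT0.le (one_le_pow₀ hk1)
  have hτB : τ * B = ε / k ^ (19 * d) := by rw [hτ]; field_simp
  have hτB' : τ * B ≤ ε := by rw [hτB]; exact div_le_self hε.le (one_le_pow₀ hk1)
  have hτleB : τ ≤ B := by
    have : τ * B ≤ B * B := hτB'.trans (hεT.trans (by nlinarith))
    exact le_of_mul_le_mul_right this hB0
  -- The value of `b²` for which the heavy sets contribute exactly `τB`. One factor `ε` comes from
  -- `τB` and `d` more from `(τ/B)^d`.
  set c := τ * B * (τ / B) ^ d with hc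
  have hc0 : 0 < c := by positivity
  have hcle : c ≤ τ * B := mul_le_of_le_one_right (by positivity)
    (pow_le_one₀ (by positivity) ((div_le_one hB0).2 hτleB))
  have hb2 : √c ^ 2 = c := Real.sq_sqrt hc0.le
  have hcB : c * (B / τ) ^ d = τ * B := by
    rw [hc, mul_assoc, ← mul_pow]
    have : τ / B * (B / τ) = 1 := by field_simp
    rw [this, one_pow, mul_one]
  refine ⟨B, τ, √c, ?_, hτ0, Real.sqrt_pos.2 hc0, ?_, ?_, ?_⟩
  · rw [hB]
    gcongr
    calc (2 : ℝ) * 30 ^ d ≤ 2 ^ d * 30 ^ d := by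
          gcongr
          exact le_self_pow₀ (by norm_num) (by omega)
      _ = 60 ^ d := by rw [← mul_pow]; norm_num
      _ ≤ (2 ^ 6) ^ d := by gcongr; norm_num
      _ ≤ (k ^ 6) ^ d := by gcongr
      _ = k ^ (6 * d) := by rw [pow_mul]
  · rw [Real.sqrt_le_left hT0.le]
    exact hcle.trans (hτB'.trans hεT)
  · rw [hb2, mul_add c, mul_one, hcB]
    have h27 : 27 ≤ k ^ (5 * d) := by
      calc (27 : ℝ) ≤ 2 ^ 5 := by norm_num
        _ ≤ k ^ 5 := by gcongr
        _ ≤ k ^ (5 * d) := pow_le_pow_right₀ hk1 (by omega)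
    calc k ^ (14 * d) * (9 * (τ * B + (c + τ * B))) ≤ k ^ (14 * d) * (27 * (τ * B)) := by
          exact mul_le_mul_of_nonneg_left (by linarith) (by positivity)
      _ ≤ k ^ (14 * d) * (k ^ (5 * d) * (τ * B)) := by gcongr
      _ = ε := by
          rw [hτB, ← mul_assoc, ← pow_add, (by ring : 14 * d + 5 * d = 19 * d)]
          field_simp
  · have e1 : 1 / c = k ^ (31 * d * d + 19 * d) * T ^ (2 * d) * (ε ^ (d + 1))⁻¹ := by
      have h1 : τ / B = ε / (k ^ (31 * d) * T ^ 2) := by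
        rw [hτ, hB]; field_simp; ring
      rw [hc, hτB, h1, div_pow, mul_pow, ← pow_mul, ← pow_mul, pow_succ ε, pow_add]
      field_simp
    rw [hb2, div_eq_mul_one_div, e1]
    have h16 : (16 : ℝ) ≤ k ^ 4 := by
      calc (16 : ℝ) = 2 ^ 4 := by norm_num
        _ ≤ k ^ 4 := by gcongr
    have hdd : d ≤ d ^ 2 := Nat.le_self_pow two_ne_zero d
    have hdd' : d * d = d ^ 2 := (pow_two d).symm
    rw [← mul_assoc]
    gcongr
    calc 16 * T ^ 2 * (k ^ (31 * d * d + 19 * d) * T ^ (2 * d))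
        ≤ k ^ 4 * T ^ 2 * (k ^ (31 * d * d + 19 * d) * T ^ (2 * d)) := by gcongr
      _ = k ^ (4 + 31 * d * d + 19 * d) * T ^ (2 + 2 * d) := by ring
      _ ≤ k ^ (54 * d ^ 2) * T ^ (54 * d ^ 2) := by
          have hle : 4 + 31 * d * d + 19 * d ≤ 54 * d ^ 2 := by
            rw [mul_assoc, hdd']; omega
          exact mul_le_mul (pow_le_pow_right₀ hk1 hle) (pow_le_pow_right₀ hT (by omega))
            (by positivity) (by positivity)
      _ = _ := (mul_pow _ _ _).symm

lemma log_count_le {k N n δ : ℝ} {d : ℕ} (hd : 1 ≤ d) (hk : 2 ≤ k) (hn : 1 ≤ n) (hδ : 0 < δ)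
    (hδ1 : δ ≤ 1) (hN0 : 0 ≤ N) (hN : N + 1 ≤ n * k ^ 5) :
    Real.log (2 * (N + 1) ^ d / δ) ≤ 11 * k * d * Real.log (max (n / δ) 2) := by
  set M := max (n / δ) 2 with hM
  have hM2 : 2 ≤ M := le_max_right _ _
  have hMn : n / δ ≤ M := le_max_left _ _
  have hd' : (1 : ℝ) ≤ d := by exact_mod_cast hd
  have hL : 1 / 2 ≤ Real.log M := by
    have := Real.log_le_log (by norm_num) hM2
    linarith [Real.log_two_gt_d9]
  have hlogk : Real.log k ≤ k := (Real.log_le_sub_one_of_pos (by linarith)).trans (by linarith)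
  have h1 : 2 * (N + 1) ^ d / δ ≤ M ^ (d + 1) * k ^ (5 * d) := by
    -- Replacing `δ` by `δ^d` in the denominator makes the ratio a power of `n/δ`.
    have hδd : δ ^ d ≤ δ := pow_le_of_le_one hδ.le hδ1 (by omega)
    calc 2 * (N + 1) ^ d / δ ≤ 2 * (n * k ^ 5) ^ d / δ ^ d := by gcongr
      _ = 2 * ((n / δ) ^ d * k ^ (5 * d)) := by rw [mul_pow, div_pow, pow_mul]; ring
      _ ≤ M * (M ^ d * k ^ (5 * d)) := by gcongr
      _ = _ := by ring
  calc Real.log (2 * (N + 1) ^ d / δ) ≤ Real.log (M ^ (d + 1) * k ^ (5 * d)) :=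
        Real.log_le_log (by positivity) h1
    _ = (d + 1) * Real.log M + 5 * d * Real.log k := by
        rw [Real.log_mul (by positivity) (by positivity), Real.log_pow, Real.log_pow]
        push_cast; ring
    _ ≤ (d + 1) * Real.log M + 5 * d * k := by gcongr
    _ ≤ 11 * k * d * Real.log M := by
        have h2 : (d + 1) * Real.log M ≤ k * d * Real.log M := by
          gcongr; nlinarith
        have h3 : 5 * d * k * 1 ≤ 5 * d * k * (2 * Real.log M) := by gcongr; linarith
        linarith

lemma exists_real_coeff (hK : 0 < K) {d : ℕ} {A : Op K n} (hA : A.IsHermitian)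
    (hdeg : DegreeLE d A) : ∃ a : (Fin n → GMIndex K) → ℝ,
      (∀ α, d < weight α → a α = 0) ∧ A = ∑ α, (a α : ℂ) • gmTensor α := by
  obtain ⟨a, ha, rfl⟩ := hdeg
  refine ⟨fun α => (a α).re, fun α h => by simp [ha α h], ?_⟩
  exact Finset.sum_congr rfl fun α _ => by
    rw [coeff_real_of_isHermitian hK hA]; rfl

lemma abs_vertex_le {ι : Type*} (x : ι → Bool) (i : ι) : |vertex x i| ≤ 1 := (abs_sgn _).le

/-- The learner succeeds with high probability on every bounded observable of low degree. -/
lemma learner_success (hK : 2 ≤ K) {d s : ℕ} {B τ b T δ ε : ℝ} (hd : 1 ≤ d) (hT : 0 < T)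
    (hB : 2 * 30 ^ d * T ≤ B) (hτ : 0 < τ) (hb : 0 < b) (hbT : b ≤ T) (hs : 0 < s) (hδ : 0 < δ)
    (herr : (K : ℝ) ^ (14 * d) * (9 * (τ * B + b ^ 2 * (1 + (B / τ) ^ d))) ≤ ε)
    (hsδ : 16 * T ^ 2 / b ^ 2 *
      Real.log (2 * (Fintype.card (Fin n × Traceless K) + 1) ^ d / δ) ≤ s)
    {A : Op K n} (hA : A.IsHermitian) (hdeg : DegreeLE d A) (hAT : opNorm A ≤ T) :
    1 - δ ≤ iidUniformProb (univ.image (vertexState : _ → Op K n)) s fun ρ =>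
      normSq₂ (A - learner K n d b (samples A ρ)) ≤ ε := by
  have hK0 : 0 < K := by omega
  obtain ⟨a, ha, rfl⟩ := exists_real_coeff hK0 hA hdeg
  have hpoly : ∀ y : Fin n × Traceless K → ℝ, (∀ i, |y i| ≤ 1) → |poly (cubeCoeff a) y| ≤ T := by
    intro y hy
    have h := norm_trace_mul_le_of_isProductState (A := ∑ α, (a α : ℂ) • gmTensor α)
      (prodState_isProductState hK hy)
    rw [trace_mul_prodState hK0, Complex.norm_real, Real.norm_eq_abs] at h
    exact h.trans hAT
  have hvert : ∀ x, |poly (cubeCoeff a) (vertex x)| ≤ T := fun x => hpoly _ (abs_vertex_le x)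
  have hinfl := (sum_infl_le hd (cubeCoeff_eq_zero ha) hpoly).trans hB
  have hgood := le_card_emp_good hd hvert hT hb hbT hs hδ hsδ
  rw [iidUniformProb_image (vertexState_injective hK0), le_div_iff₀ (by
    have : 0 < Fintype.card (Fin n × Traceless K → Bool) := Fintype.card_pos
    positivity)]
  refine hgood.trans ?_
  refine Nat.cast_le.2 (card_filter_le_natCard fun x hx => ?_)
  refine (normSq₂_sub_learner_le hK0 b ha x).trans (le_trans ?_ herr)
  gcongr
  exact sum_sub_threshold_sq_le (cubeCoeff_eq_zero ha) hτ hinfl hx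

end Qudit

end

/-! ### Assembly and constants -/

theorem theorem4p2 :
    ∃ C C' : ℝ, 0 < C ∧ 0 < C' ∧
      ∀ (K n d : ℕ) (ε δ t : ℝ), 2 ≤ K → 1 ≤ n → 1 ≤ d → 0 < ε → 0 < δ → 0 < t →
        ∃ (S : Finset (Qudit.Op K n)) (s : ℕ)
          (learn : (Fin s → Qudit.Op K n × ℂ) → Qudit.Op K n),
          S.Nonempty ∧ (∀ ρ ∈ S, Qudit.IsProductState ρ) ∧
          (s : ℝ) ≤ C' * (((K : ℝ) * max t 1) ^ (C * (d : ℝ) ^ 2) * (d : ℝ) ^ 2 *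
            (ε ^ (d + 1))⁻¹ * Real.log (max ((n : ℝ) / δ) 2)) ∧
          (∀ data, (learn data).IsHermitian) ∧
          ∀ A : Qudit.Op K n, A.IsHermitian → Qudit.DegreeLE d A → Qudit.opNorm A ≤ t →
            1 - δ ≤ Qudit.iidUniformProb S s fun ρ =>
              Qudit.normSq₂ (A - learn (Qudit.samples A ρ)) ≤ ε := by
  classical
  -- The exponent 54 comes from `exists_parameters`, and one more `d²` absorbs the factor `K` of the
  -- logarithmic bound. The constant is 11 from that bound, doubled by rounding the sample size up.
  refine ⟨55, 22, by norm_num, by norm_num, fun K n d ε δ t hK hn hd hε hδ ht => ?_⟩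
  have hK0 : 0 < K := by omega
  have hk : (2 : ℝ) ≤ K := by exact_mod_cast hK
  have hn' : (1 : ℝ) ≤ n := by exact_mod_cast hn
  have hd' : (1 : ℝ) ≤ d := by exact_mod_cast hd
  have hL : 0 ≤ Real.log (max ((n : ℝ) / δ) 2) :=
    Real.log_nonneg (le_trans (by norm_num) (le_max_right _ _))
  have hinj := Qudit.vertexState_injective (n := n) hK0
  have hne : (Finset.univ.image (Qudit.vertexState : _ → Qudit.Op K n)).Nonempty :=
    Finset.univ_nonempty.image _
  have hprod : ∀ ρ ∈ Finset.univ.image (Qudit.vertexState : _ → Qudit.Op K n),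
      Qudit.IsProductState ρ := by
    intro ρ hρ
    obtain ⟨x, _, rfl⟩ := Finset.mem_image.1 hρ
    exact Qudit.prodState_isProductState hK (Qudit.abs_vertex_le x)
  set T := max t 1 with hTdef
  have hT1 : 1 ≤ T := le_max_right _ _
  have htT : t ≤ T := le_max_left _ _
  have hpow : ((K : ℝ) * T) ^ ((55 : ℝ) * (d : ℝ) ^ 2) = ((K : ℝ) * T) ^ (55 * d ^ 2) := by
    rw [← Real.rpow_natCast _ (55 * d ^ 2)]; norm_num
  rw [hpow]
  -- For `δ ≥ 1` or `ε ≥ t²` no samples are needed. Otherwise `ε < t² ≤ T²`, which the choice of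
  -- parameters requires.
  rcases le_or_gt 1 δ with hδ1 | hδ1
  · refine ⟨_, 0, fun _ => 0, hne, hprod, ?_, fun _ => Matrix.isHermitian_zero, fun A _ _ _ => ?_⟩
    · rw [Nat.cast_zero]; positivity
    · exact le_trans (by linarith) (Qudit.iidUniformProb_nonneg _ _ _)
  rcases le_or_gt (t ^ 2) ε with hεt | hεt
  · refine ⟨_, 0, fun _ => 0, hne, hprod, ?_, fun _ => Matrix.isHermitian_zero,
      fun A _ _ hA => ?_⟩
    · rw [Nat.cast_zero]; positivity
    · rw [Qudit.iidUniformProb_of_forall hinj]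
      · linarith
      · intro ρ
        rw [sub_zero]
        exact (Qudit.normSq₂_le_opNorm_sq hK0 A).trans
          ((pow_le_pow_left₀ (Qudit.opNorm_nonneg A) hA 2).trans hεt)
  obtain ⟨B, τ, b, hB, hτ, hb, hbT, herr, hb2⟩ := Qudit.exists_parameters (T := T) hd hk hT1 hε
    (hεt.le.trans (pow_le_pow_left₀ ht.le htT 2))
  set N : ℝ := ((Fintype.card (Fin n × Qudit.Traceless K) : ℕ) : ℝ) with hN
  have hNle : N + 1 ≤ n * (K : ℝ) ^ 5 := by
    have h1 : N ≤ n * (K : ℝ) ^ 4 := by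
      rw [hN, Fintype.card_prod, Fintype.card_fin]
      exact_mod_cast Nat.mul_le_mul_left n (Qudit.card_traceless_le hK)
    have h2 : 1 ≤ n * (K : ℝ) ^ 4 := one_le_mul_of_one_le_of_one_le hn' (one_le_pow₀ (by linarith))
    calc N + 1 ≤ n * (K : ℝ) ^ 4 * 2 := by linarith
      _ ≤ n * (K : ℝ) ^ 4 * K := by gcongr
      _ = _ := by ring
  have hlog := Qudit.log_count_le hd hk hn' hδ hδ1.le (by positivity) hNle
  set s₀ := 16 * T ^ 2 / b ^ 2 * Real.log (2 * (N + 1) ^ d / δ) with hs₀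
  -- This makes the rounded sample size positive and at most `2 s₀`.
  have hs₀1 : 1 ≤ s₀ := by
    have h1 : 16 ≤ 16 * T ^ 2 / b ^ 2 := by
      rw [le_div_iff₀ (by positivity)]; gcongr
    have h2 : 1 / 2 ≤ Real.log (2 * (N + 1) ^ d / δ) := by
      have h3 : 2 ≤ 2 * (N + 1) ^ d / δ := by
        rw [le_div_iff₀ hδ]
        have : 1 ≤ (N + 1) ^ d := one_le_pow₀ (by linarith [show 0 ≤ N by positivity])
        nlinarith
      have := Real.log_le_log (by norm_num) h3
      linarith [Real.log_two_gt_d9]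
    nlinarith
  refine ⟨_, ⌈s₀⌉₊, Qudit.learner K n d b, hne, hprod, ?_, fun data =>
    Qudit.learner_isHermitian d b data, fun A hA hdeg hAt => ?_⟩
  · have hKT : 1 ≤ (K : ℝ) * T := one_le_mul_of_one_le_of_one_le (by linarith) hT1
    have hKle : (K : ℝ) ≤ ((K : ℝ) * T) ^ (d ^ 2) :=
      (le_mul_of_one_le_right (by positivity) hT1).trans
        (le_self_pow₀ hKT (pow_ne_zero 2 (by omega)))
    calc (⌈s₀⌉₊ : ℝ) ≤ s₀ + 1 := (Nat.ceil_lt_add_one (by linarith)).le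
      _ ≤ 2 * s₀ := by linarith
      _ ≤ 2 * (((K : ℝ) * T) ^ (54 * d ^ 2) * (ε ^ (d + 1))⁻¹ *
            (11 * K * d * Real.log (max ((n : ℝ) / δ) 2))) := by
          rw [hs₀]
          have : 0 ≤ Real.log (2 * (N + 1) ^ d / δ) := by
            by_contra hneg
            have : s₀ ≤ 0 := mul_nonpos_of_nonneg_of_nonpos (by positivity) (by linarith)
            linarith
          gcongr
      _ ≤ 2 * (((K : ℝ) * T) ^ (54 * d ^ 2) * (ε ^ (d + 1))⁻¹ *
            (11 * ((K : ℝ) * T) ^ (d ^ 2) * (d : ℝ) ^ 2 *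
              Real.log (max ((n : ℝ) / δ) 2))) := by
          gcongr
          exact le_self_pow₀ hd' two_ne_zero
      _ = _ := by
          rw [show 55 * d ^ 2 = 54 * d ^ 2 + d ^ 2 by ring, pow_add]
          ring
  · exact Qudit.learner_success hK hd (by linarith) hB hτ hb hbT
      (Nat.ceil_pos.2 (by linarith)) hδ herr (Nat.le_ceil _) hA hdeg (hAt.trans htT)
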